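/- **Theorem (realisation of a valuation as a random variable).** Let $(X,d)$ be an effectively separable computable metric space, and let $P$ be the fair-coin measure on $\Omega=\{0,1\}^\omega$. There is a type-two machine which, given any name of any continuous valuation $\nu$ on $X$ with $\nu(X)=1$, computes a name of a measurable random variable $Z:\Omega\rightsquigarrow X$ such that $\Pr(Z\in U)=\nu(U)$ for every open $U\subseteq X$. (The random variable $Z$ may depend on the name of $\nu$.) Here the terms have the following meaning. * *Names* are points of Baire space $\mathbb N^{\mathbb N}$. A representation of $X$ is a partial surjection $\delta$ from names to $X$. The machine computes a partial function on names. A name of a function between represented objects codes a partial continuous function on names that realises it: it says, for each finite prefix of the input, whether the $n$-th output symbol is already determined and which symbol it is. * $(X,d)$ with $\delta$ is a *computable metric space* if $\delta$ is an admissible quotient representation for the metric topology, $d:X\times X\to\mathbb R$ is computable, and from $x$ and an open $U\ni x$ one can compute some $\varepsilon>0$ with $B(x,\varepsilon)\subseteq U$. It is *effectively separable* if it has a computable dense sequence. * An open set is named as a function $X\to\mathbb S$ to Sierpiński space. A *continuous valuation* is a Scott-continuous $\nu:\mathcal O(X)\to[0,\infty]$ with $\nu(\emptyset)=0$ and $\nu(U)+\nu(V)=\nu(U\cup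 V)+\nu(U\cap V)$. It is named as a function $\mathcal O(X)\to[0,\infty]_<$, where a name of $h\in[0,\infty]_<$ is an increasing sequence of non-negative rationals with supremum $h$. * *Continuous random variables* are the continuous functions $Y:\Omega\to X$, named as functions, with the Fan metric $d(Y,Y')=\sup\{\varepsilon\in\mathbb Q^+\mid P(d(Y(\omega),Y'(\omega))>\varepsilon)>\varepsilon\}$ (the supremum of the empty set being $0$). *Measurable random variables* are the elements of the completion of this space; a name of $Z$ consists of names of a sequence of continuous random variables $Y_n\to Z$ with $d(Y_m,Y_n)<2^{-\min(m,n)}$ for all $m,n$. * $\Pr(Z\in U)=\sup\{P(Y\in V)-\varepsilon \mid \varepsilon\in\mathbb Q^+,\ V\subseteq I_\varepsilon(U),\ d(Y,Z)<\varepsilon\}$, where $Y$ ranges over continuous random variables, $V$ over open sets, and $I_\varepsilon(U)=\{x\in U\mid \exists\eta>0,\ B(x,\varepsilon+\eta)\subseteq U\}$. -/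

import Mathlib

open MeasureTheory Topology TopologicalSpace

noncomputable section

namespace TTE

/-! ### Type-two computability

Names are points of Baire space `ℕ → ℕ`.  A partial continuous function from Baire space to itself
is itself coded by a point `F` of Baire space: `F` tells, for each finite prefix of the input,
whether the `n`-th output symbol can already be written and which symbol it is.  The function is
machine computable when `F` is a computable function of natural numbers. -/

/-- The code of the first `k` symbols of `p`. -/
def prefixCode (p : ℕ → ℕ) (k : ℕ) : ℕ :=
  Encodable.encode ((List.range k).map p)

/-- The partial function coded by `F` is defined at the input `p`, with output `r`: for each `n`,
reading longer and longer prefixes of `p`, the first non-zero answer of `F` is `r n + 1`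
(the answer `0` means that more input is needed). -/
def Applies (F p r : ℕ → ℕ) : Prop :=
  ∀ n, ∃ k, F (Nat.pair n (prefixCode p k)) = r n + 1 ∧
    ∀ j < k, F (Nat.pair n (prefixCode p j)) = 0

/-- `N p a` means that `p` is a name of `a`. -/
abbrev Naming (A : Type*) := (ℕ → ℕ) → A → Prop

/-- `F` codes a function on names that realises the map `f`. -/
def Realizes {A B : Type*} (NA : Naming A) (NB : Naming B) (F : ℕ → ℕ) (f : A → B) : Prop :=
  ∀ p a, NA p a → ∃ r, Applies F p r ∧ NB r (f a)

/-- `f` is realised by a machine-computable function on names. -/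
def IsComputableMap {A B : Type*} (NA : Naming A) (NB : Naming B) (f : A → B) : Prop :=
  ∃ F : ℕ → ℕ, Computable F ∧ Realizes NA NB F f

/-- The multivalued map `R : A ⇉ B` is computably selectable: some machine-computable function takes
every name of every `a` to a name of some `b` with `R a b`.  The element `b` may depend on the
name of `a`. -/
def ComputablySelectable {A B : Type*} (NA : Naming A) (NB : Naming B) (R : A → B → Prop) : Prop :=
  ∃ F : ℕ → ℕ, Computable F ∧ ∀ p a, NA p a → ∃ r b, Applies F p r ∧ NB r b ∧ R a b

/-- The interleaving of two names. -/
def interleave (p q : ℕ → ℕ) (n : ℕ) : ℕ :=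
  if n % 2 = 0 then p (n / 2) else q (n / 2)

/-- The `n`-th of the countably many names combined in `p`. -/
def component (p : ℕ → ℕ) (n : ℕ) : ℕ → ℕ := fun i => p (Nat.pair n i)

/-- The product of two types. -/
def prodNaming {A B : Type*} (NA : Naming A) (NB : Naming B) : Naming (A × B) :=
  fun p z => ∃ q r, p = interleave q r ∧ NA q z.1 ∧ NB r z.2

/-- Sierpinski space: *true* is the value that is recognised in finite time. -/
def sierpinskiNaming : Naming Prop := fun p s => s ↔ ∃ n, p n ≠ 0

/-- The rational number with code `⟨a, ⟨b, c⟩⟩` is `(a - b) / (c + 1)`. -/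
def ratOfCode (k : ℕ) : ℚ :=
  ((k.unpair.1 : ℚ) - (k.unpair.2.unpair.1 : ℚ)) / ((k.unpair.2.unpair.2 : ℚ) + 1)

/-- The non-negative rational number with code `⟨a, b⟩` is `a / (b + 1)`. -/
def nnratOfCode (k : ℕ) : NNRat := (k.unpair.1 : NNRat) / ((k.unpair.2 : NNRat) + 1)

/-- The real numbers: a name lists rational approximations with errors at most `2⁻ⁿ`. -/
def realNaming : Naming ℝ := fun p x => ∀ n, |x - (ratOfCode (p n) : ℝ)| ≤ (2⁻¹ : ℝ) ^ n

/-- The lower half-line `[0, ∞]`: a name lists an increasing sequence of non-negative rational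
numbers with the given supremum. -/
def lowerNaming : Naming ENNReal := fun p h =>
  Monotone (fun n => nnratOfCode (p n)) ∧
    ⨆ n, ((nnratOfCode (p n) : NNReal) : ENNReal) = h

/-- Cantor space. -/
def cantorNaming : Naming (ℕ → Bool) := fun p ω => ∀ n, p n = (ω n).toNat

/-! ### Represented spaces and computable metric spaces -/

/-- A representation of `X`: a partial surjective function from names to `X`. -/
structure Representation (X : Type*) where
  toPFun : (ℕ → ℕ) →. X
  surjective : ∀ x, ∃ p, x ∈ toPFun p

/-- `p` is a name of `x`. -/
def Representation.Names {X : Type*} (δ : Representation X) : Naming X := fun p x => x ∈ δ.toPFun p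

/-- `δ` is an admissible quotient representation of the topological space `X`. -/
structure IsAdmissibleQuotient {X : Type*} [TopologicalSpace X] (δ : Representation X) : Prop where
  isQuotientMap : IsQuotientMap δ.toPFun.asSubtype
  admissible : ∀ (D : Set (ℕ → ℕ)) (φ : D → X), Continuous φ →
    ∃ η : D → (ℕ → ℕ), Continuous η ∧ ∀ p, δ.Names (η p) (φ p)

/-- The type of open sets, `𝒪(X) = (X → 𝕊)`: a name of `U` realises its characteristic function. -/
def opensNaming {X : Type*} [TopologicalSpace X] (δ : Representation X) : Naming (Opens X) :=
  fun p U => Realizes δ.Names sierpinskiNaming p (fun x => x ∈ U)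

/-- A computable metric space: the representation is admissible for the metric topology, the metric
is computable, and from a point `x` and an open set `U` containing `x` one can compute some `ε > 0`
with `B(x, ε) ⊆ U`. -/
structure IsComputableMetricSpace {X : Type*} [MetricSpace X] (δ : Representation X) : Prop where
  isAdmissibleQuotient : IsAdmissibleQuotient δ
  dist_computable : IsComputableMap (prodNaming δ.Names δ.Names) realNaming
    (fun z : X × X => dist z.1 z.2)
  radius_computable : ComputablySelectable
    (fun p (z : {z : X × Opens X // z.1 ∈ z.2}) => prodNaming δ.Names (opensNaming δ) p z.1)
    realNaming (fun z ε => 0 < ε ∧ Metric.ball z.1.1 ε ⊆ (z.1.2 : Set X))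

/-- There is a computable dense sequence. -/
def EffectivelySeparable {X : Type*} [TopologicalSpace X] (δ : Representation X) : Prop :=
  ∃ ξ : ℕ → X, DenseRange ξ ∧
    ∃ s : ℕ → ℕ, Computable s ∧ ∀ n, δ.Names (component s n) (ξ n)

/-! ### Valuations -/

/-- A continuous valuation on `X`. -/
structure Valuation (X : Type*) [TopologicalSpace X] where
  toFun : Opens X → ENNReal
  scottContinuous : ScottContinuous toFun
  map_empty : toFun ⊥ = 0
  modular : ∀ U V, toFun U + toFun V = toFun (U ⊔ V) + toFun (U ⊓ V)

/-- The valuations of total mass one. -/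
abbrev ProbabilityValuation (X : Type*) [TopologicalSpace X] := {ν : Valuation X // ν.toFun ⊤ = 1}

/-- A name of `ν` realises the function `ν` from open sets to the lower half-line. -/
def probabilityValuationNaming {X : Type*} [TopologicalSpace X] (δ : Representation X) :
    Naming (ProbabilityValuation X) :=
  fun p ν => Realizes (opensNaming δ) lowerNaming p ν.1.toFun

/-! ### Random variables on Cantor space -/

/-- The fair-coin measure on `{0,1}^ω`. -/
def coinMeasure : Measure (ℕ → Bool) :=
  Measure.infinitePi fun _ : ℕ => (PMF.uniformOfFintype Bool).toMeasure

instance : IsProbabilityMeasure coinMeasure := by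
  unfold coinMeasure; infer_instance

/-- Continuous random variables with base space `{0,1}^ω`. (A structure, so that the uniform metric
on `C(ℕ → Bool, X)` does not interfere with the Fan metric.) -/
structure ContinuousRV (X : Type*) [TopologicalSpace X] where
  map : C(ℕ → Bool, X)

/-- A name of a continuous random variable realises it as a function. -/
def continuousRVNaming {X : Type*} [TopologicalSpace X] (δ : Representation X) :
    Naming (ContinuousRV X) :=
  fun p Y => Realizes cantorNaming δ.Names p Y.map

variable {X : Type*} [MetricSpace X]

/-- The rational numbers `ε > 0` with `P(d(Y,Z) > ε) > ε`. -/
def fanSet (Y Z : ContinuousRV X) : Set ℝ :=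
  {ε | (∃ q : ℚ, 0 < q ∧ (q : ℝ) = ε) ∧ ε < coinMeasure.real {ω | ε < dist (Y.map ω) (Z.map ω)}}

/-- The Fan metric. -/
def fanDist (Y Z : ContinuousRV X) : ℝ := sSup (fanSet Y Z)

theorem fanSet_bddAbove (Y Z : ContinuousRV X) : BddAbove (fanSet Y Z) :=
  ⟨1, fun _ h => h.2.le.trans measureReal_le_one⟩

theorem fanDist_nonneg (Y Z : ContinuousRV X) : 0 ≤ fanDist Y Z := by
  refine Real.sSup_nonneg ?_
  rintro ε ⟨⟨q, hq, rfl⟩, -⟩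
  exact_mod_cast hq.le

theorem measure_le_of_fanDist_lt {Y Z : ContinuousRV X} {q : ℚ} (h : fanDist Y Z < q) :
    coinMeasure.real {ω | (q : ℝ) < dist (Y.map ω) (Z.map ω)} ≤ q := by
  by_contra! hc
  have hq : (0 : ℝ) < q := (fanDist_nonneg Y Z).trans_lt h
  exact absurd (le_csSup (fanSet_bddAbove Y Z) ⟨⟨q, by exact_mod_cast hq, rfl⟩, hc⟩) (not_le.2 h)

/-- The Fan metric makes the continuous random variables a pseudometric space. -/
instance : PseudoMetricSpace (ContinuousRV X) where
  dist := fanDist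
  dist_self Y := by
    have : fanSet Y Y = ∅ := by
      ext ε
      simp only [fanSet, dist_self, Set.mem_ofPred_eq, Set.mem_empty_iff_false, iff_false]
      rintro ⟨⟨q, hq, rfl⟩, h⟩
      have hq' : (0 : ℝ) < q := by exact_mod_cast hq
      simp [hq'.not_gt] at h
    simp [fanDist, this]
  dist_comm Y Z := by simp only [fanDist, fanSet, dist_comm]
  dist_triangle Y Z W := by
    refine Real.sSup_le ?_ (add_nonneg (fanDist_nonneg _ _) (fanDist_nonneg _ _))
    rintro ε ⟨-, hε⟩
    by_contra! hlt
    obtain ⟨a, ha, ha'⟩ := exists_rat_btwn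
      (show fanDist Y Z < fanDist Y Z + (ε - (fanDist Y Z + fanDist Z W)) / 2 by linarith)
    obtain ⟨b, hb, hb'⟩ := exists_rat_btwn
      (show fanDist Z W < fanDist Z W + (ε - (fanDist Y Z + fanDist Z W)) / 2 by linarith)
    have hsub : {ω | ε < dist (Y.map ω) (W.map ω)} ⊆
        {ω | (a : ℝ) < dist (Y.map ω) (Z.map ω)} ∪ {ω | (b : ℝ) < dist (Z.map ω) (W.map ω)} := by
      intro ω hω
      by_contra hn
      simp only [Set.mem_union, Set.mem_ofPred_eq, not_or, not_lt] at hn hω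
      have := dist_triangle (Y.map ω) (Z.map ω) (W.map ω)
      linarith [hn.1, hn.2]
    have h1 := (measureReal_mono (μ := coinMeasure) hsub).trans (measureReal_union_le _ _)
    have h2 := measure_le_of_fanDist_lt ha
    have h3 := measure_le_of_fanDist_lt hb
    linarith

/-- Measurable random variables: the completion of the continuous random variables under the
Fan metric. -/
abbrev MeasurableRV (X : Type*) [MetricSpace X] := UniformSpace.Completion (ContinuousRV X)

/-- A name of a measurable random variable `Z` is a sequence of names of continuous random
variables `Y₀, Y₁, …` with `d(Yₘ, Yₙ) < 2 ^ (-min(m,n))` and limit `Z`. -/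
def measurableRVNaming (δ : Representation X) : Naming (MeasurableRV X) :=
  fun p Z => ∃ Y : ℕ → ContinuousRV X,
    (∀ n, continuousRVNaming δ (component p n) (Y n)) ∧
    (∀ m n, dist (Y m) (Y n) < (2⁻¹ : ℝ) ^ min m n) ∧
    Filter.Tendsto (fun n => (Y n : MeasurableRV X)) Filter.atTop (𝓝 Z)

/-- `I_ε(U) = {x ∈ U | ∃ η > 0, B(x, ε + η) ⊆ U}`. -/
def shrink (ε : ℝ) (U : Set X) : Set X :=
  {x ∈ U | ∃ η > 0, Metric.ball x (ε + η) ⊆ U}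

/-- The distribution of a measurable random variable,
`Pr(Z ∈ U) = sup {P(Y ∈ V) - ε | ε ∈ ℚ⁺, V ⊆ I_ε(U), d(Y, Z) < ε}`, where `Y` ranges over the
continuous random variables and `V` over the open sets. -/
def distribution (Z : MeasurableRV X) (U : Opens X) : ℝ :=
  sSup {t : ℝ | ∃ (ε : ℚ) (V : Opens X) (Y : ContinuousRV X), 0 < ε ∧
    (V : Set X) ⊆ shrink (ε : ℝ) (U : Set X) ∧ dist (Y : MeasurableRV X) Z < (ε : ℝ) ∧
    t = coinMeasure.real {ω | Y.map ω ∈ V} - ε}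

end TTE

end

namespace TTE

/-! ### Closure properties of computable functions -/

section Computable

attribute [fun_prop] Computable
attribute [fun_prop] Computable.comp Computable.const Computable.pair

variable {α β γ : Type*} [Primcodable α] [Primcodable β] [Primcodable γ]

/-! The random variable is a limit of locally constant ones. A table of `2 ^ K` points of the dense
sequence, indexed by the first `K` coin tosses, has as its law the uniform distribution on its
entries. Call it adequate at scale `rad n` if every set `A` of words satisfies `|A| / 2 ^ K <
ν(B(A)) + rad n`, where `B(A)` is the `rad n`-neighbourhood of the points with words in `A`. This is
the one-sided Prokhorov condition. Applied to complements it also bounds the law from below, because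
both total masses are one. There are finitely many sets `A`, and each strict inequality can be
confirmed from a lower approximation of `ν`, so adequacy is semidecidable from a name of `ν`.

Adequate tables exist at every scale (`exists_quantization`): finitely many balls carry almost all
the mass, and each centre is repeated in proportion to the mass its ball adds to the earlier ones. A
finer table can moreover be chosen close in the Fan metric to a given coarser one
(`exists_rearrangement`). Adequacy of both is Hall's condition with a few dummy partners, so a
permutation of the finer table matches most of its entries to nearby entries of the coarser table.
This is the finite form of Strassen's theorem.

A dovetailed search for an adequate table close to the current one therefore never gets stuck
(`exists_next_table`, `exists_level`). The tables it finds form a Cauchy sequence with geometric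
rate, and adequacy at scales tending to zero forces the law of the limit to be `ν`
(`distribution_eq`). The search depends on the name of `ν`, and so does the limit. -/

@[fun_prop]
theorem computable_id' : Computable (fun a : α => a) := Computable.id

@[fun_prop]
theorem computable_fst {f : α → β × γ} (hf : Computable f) : Computable (fun a => (f a).1) :=
  Computable.fst.comp hf

@[fun_prop]
theorem computable_snd {f : α → β × γ} (hf : Computable f) : Computable (fun a => (f a).2) :=
  Computable.snd.comp hf

@[fun_prop]
theorem computable_add {f g : α → ℕ} (hf : Computable f) (hg : Computable g) :
    Computable (fun a => f a + g a) :=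
  Primrec.nat_add.to_comp.comp hf hg

@[fun_prop]
theorem computable_sub {f g : α → ℕ} (hf : Computable f) (hg : Computable g) :
    Computable (fun a => f a - g a) :=
  Primrec.nat_sub.to_comp.comp hf hg

@[fun_prop]
theorem computable_mul {f g : α → ℕ} (hf : Computable f) (hg : Computable g) :
    Computable (fun a => f a * g a) :=
  Primrec.nat_mul.to_comp.comp hf hg

@[fun_prop]
theorem computable_div {f g : α → ℕ} (hf : Computable f) (hg : Computable g) :
    Computable (fun a => f a / g a) :=
  Primrec.nat_div.to_comp.comp hf hg

@[fun_prop]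
theorem computable_mod {f g : α → ℕ} (hf : Computable f) (hg : Computable g) :
    Computable (fun a => f a % g a) :=
  Primrec.nat_mod.to_comp.comp hf hg

@[fun_prop]
theorem computable_natPair {f g : α → ℕ} (hf : Computable f) (hg : Computable g) :
    Computable (fun a => Nat.pair (f a) (g a)) :=
  Primrec₂.natPair.to_comp.comp hf hg

@[fun_prop]
theorem computable_unpair {f : α → ℕ} (hf : Computable f) :
    Computable (fun a => Nat.unpair (f a)) :=
  Computable.unpair.comp hf

@[fun_prop]
theorem computable_decide_lt {f g : α → ℕ} (hf : Computable f) (hg : Computable g) :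
    Computable (fun a => decide (f a < g a)) :=
  (Primrec.nat_lt.decide.to_comp.comp hf hg).of_eq fun a => by simp

@[fun_prop]
theorem computable_decide_le {f g : α → ℕ} (hf : Computable f) (hg : Computable g) :
    Computable (fun a => decide (f a ≤ g a)) :=
  (Primrec.nat_le.decide.to_comp.comp hf hg).of_eq fun a => by simp

@[fun_prop]
theorem computable_decide_eq {f g : α → ℕ} (hf : Computable f) (hg : Computable g) :
    Computable (fun a => decide (f a = g a)) :=
  (Primrec.eq.decide.to_comp.comp hf hg).of_eq fun a => by simp

@[fun_prop]
theorem computable_and {f g : α → Bool} (hf : Computable f) (hg : Computable g) :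
    Computable (fun a => f a && g a) :=
  Primrec.and.to_comp.comp hf hg

@[fun_prop]
theorem computable_or {f g : α → Bool} (hf : Computable f) (hg : Computable g) :
    Computable (fun a => f a || g a) :=
  Primrec.or.to_comp.comp hf hg

@[fun_prop]
theorem computable_cond {c : α → Bool} {f g : α → β} (hc : Computable c) (hf : Computable f)
    (hg : Computable g) : Computable (fun a => bif c a then f a else g a) :=
  Computable.cond hc hf hg

@[fun_prop]
theorem computable_ite {c : α → Prop} [DecidablePred c] {f g : α → β}
    (hc : Computable fun a => decide (c a)) (hf : Computable f) (hg : Computable g) :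
    Computable (fun a => if c a then f a else g a) :=
  (Computable.cond hc hf hg).of_eq fun a => by by_cases h : c a <;> simp [h]

@[fun_prop]
theorem computable_toNat {f : α → Bool} (hf : Computable f) : Computable (fun a => (f a).toNat) :=
  (computable_cond hf (Computable.const 1) (Computable.const 0)).of_eq fun a => by
    cases f a <;> rfl

@[fun_prop]
theorem computable_list_length {f : α → List β} (hf : Computable f) :
    Computable (fun a => (f a).length) :=
  Computable.list_length.comp hf

@[fun_prop]
theorem computable_list_getD {f : α → List ℕ} {g : α → ℕ} (hf : Computable f)
    (hg : Computable g) : Computable (fun a => (f a).getD (g a) 0) :=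
  (Primrec.list_getD 0).to_comp.comp hf hg

@[fun_prop]
theorem computable_ofNat {δ : Type*} [Denumerable δ] {f : α → ℕ} (hf : Computable f) :
    Computable (fun a => Denumerable.ofNat δ (f a)) :=
  (Computable.ofNat δ).comp hf

@[fun_prop]
theorem computable_encode {f : α → β} (hf : Computable f) :
    Computable (fun a => Encodable.encode (f a)) :=
  Computable.encode.comp hf

theorem computable_natRec {t : α → ℕ} {g : α → β} {h : α → ℕ → β → β} (ht : Computable t)
    (hg : Computable g) (hh : Computable fun x : α × ℕ × β => h x.1 x.2.1 x.2.2) :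
    Computable fun a => Nat.rec (motive := fun _ => β) (g a) (h a) (t a) :=
  Computable.nat_rec ht hg (h := fun a x => h a x.1 x.2) hh

theorem computable_sum_range {f : α → ℕ → ℕ} {t : α → ℕ} (ht : Computable t)
    (hf : Computable fun x : α × ℕ => f x.1 x.2) :
    Computable fun a => ∑ i ∈ Finset.range (t a), f a i := by
  refine (computable_natRec (h := fun a i s => s + f a i) ht (Computable.const 0) ?_).of_eq ?_
  · exact computable_add (by fun_prop)
      (hf.comp (f := fun x : α × ℕ => f x.1 x.2) (g := fun x : α × ℕ × ℕ => (x.1, x.2.1))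
        (by fun_prop))
  · intro a
    induction t a with
    | zero => rfl
    | succ n ih => rw [Finset.sum_range_succ, ← ih]

theorem computable_pow {f g : α → ℕ} (hf : Computable f) (hg : Computable g) :
    Computable (fun a => f a ^ g a) := by
  refine (computable_natRec (h := fun a _ s => s * f a) hg (Computable.const 1) ?_).of_eq ?_
  · fun_prop
  · intro a
    induction g a with
    | zero => rfl
    | succ n ih => rw [pow_succ, ← ih]

attribute [fun_prop] computable_pow

/-- `f` holds somewhere below `t`. -/
def existsBelow (f : ℕ → Bool) (t : ℕ) : Bool := decide (∃ k < t, f k = true)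

/-- `f` holds everywhere below `t`. -/
def forallBelow (f : ℕ → Bool) (t : ℕ) : Bool := decide (∀ k < t, f k = true)

theorem computable_existsBelow {f : α → ℕ → Bool} {t : α → ℕ} (ht : Computable t)
    (hf : Computable fun x : α × ℕ => f x.1 x.2) :
    Computable fun a => existsBelow (f a) (t a) := by
  refine (computable_natRec (h := fun a i s => s || f a i) ht (Computable.const false) ?_).of_eq ?_
  · exact computable_or (by fun_prop)
      (hf.comp (f := fun x : α × ℕ => f x.1 x.2) (g := fun x : α × ℕ × Bool => (x.1, x.2.1))
        (by fun_prop))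
  · intro a
    unfold existsBelow
    induction t a with
    | zero => simp
    | succ n ih =>
      simp only [ih]
      rw [Bool.eq_iff_iff]
      simp only [Bool.or_eq_true, decide_eq_true_eq, Nat.exists_lt_succ_right]

theorem computable_forallBelow {f : α → ℕ → Bool} {t : α → ℕ} (ht : Computable t)
    (hf : Computable fun x : α × ℕ => f x.1 x.2) :
    Computable fun a => forallBelow (f a) (t a) := by
  refine (computable_natRec (h := fun a i s => s && f a i) ht (Computable.const true) ?_).of_eq ?_
  · exact computable_and (by fun_prop)
      (hf.comp (f := fun x : α × ℕ => f x.1 x.2) (g := fun x : α × ℕ × Bool => (x.1, x.2.1))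
        (by fun_prop))
  · intro a
    unfold forallBelow
    induction t a with
    | zero => simp
    | succ n ih =>
      simp only [ih]
      rw [Bool.eq_iff_iff]
      simp only [Bool.and_eq_true, decide_eq_true_eq, Nat.forall_lt_succ_right]

theorem computable_prefixCode {q : α → ℕ → ℕ} {k : α → ℕ} (hk : Computable k)
    (hq : Computable fun x : α × ℕ => q x.1 x.2) :
    Computable fun a => prefixCode (q a) (k a) := by
  refine computable_encode ((computable_natRec (h := fun a i s => s ++ [q a i]) hk
    (Computable.const ([] : List ℕ)) ?_).of_eq ?_)
  · exact Computable.list_concat.comp (f := fun (l : List ℕ) a => l ++ [a])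
      (g := fun x : α × ℕ × List ℕ => x.2.2) (by fun_prop)
      (hq.comp (f := fun x : α × ℕ => q x.1 x.2) (g := fun x : α × ℕ × List ℕ => (x.1, x.2.1))
        (by fun_prop))
  · intro a
    induction k a with
    | zero => rfl
    | succ n ih => simp only [ih, List.range_succ, List.map_append, List.map_cons, List.map_nil]

end Computable

/-! ### Step-bounded evaluation of a coded function -/

/-- The first non-zero value of `f` below `t`, or `0` when there is none. -/
def firstNonzero (f : ℕ → ℕ) (t : ℕ) : ℕ :=
  Nat.rec 0 (fun k v => if v = 0 then f k else v) t

theorem firstNonzero_succ (f : ℕ → ℕ) (t : ℕ) :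
    firstNonzero f (t + 1) = if firstNonzero f t = 0 then f t else firstNonzero f t := rfl

theorem firstNonzero_congr {f g : ℕ → ℕ} {t : ℕ} (h : ∀ k < t, f k = g k) :
    firstNonzero f t = firstNonzero g t := by
  induction t with
  | zero => rfl
  | succ t ih =>
    rw [firstNonzero_succ, firstNonzero_succ, ih fun k hk => h k (by omega), h t (by omega)]

theorem firstNonzero_eq_zero {f : ℕ → ℕ} {t : ℕ} (h : ∀ k < t, f k = 0) :
    firstNonzero f t = 0 := by
  induction t with
  | zero => rfl
  | succ t ih => simp [firstNonzero_succ, ih fun k hk => h k (by omega), h t (by omega)]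

theorem firstNonzero_eq {f : ℕ → ℕ} {k t v : ℕ} (hk : k < t) (hv : f k = v + 1)
    (h0 : ∀ j < k, f j = 0) : firstNonzero f t = v + 1 := by
  induction t with
  | zero => omega
  | succ t ih =>
    rw [firstNonzero_succ]
    rcases Nat.lt_succ_iff_lt_or_eq.1 hk with hlt | rfl
    · simp [ih hlt]
    · simp [firstNonzero_eq_zero h0, hv]

/-- The answer of the function coded by `F` at the input `q` for the `n`-th output symbol, using
fewer than `t` input symbols: the symbol plus one, or `0` when more input is needed. -/
def evalAt (F q : ℕ → ℕ) (n t : ℕ) : ℕ :=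
  firstNonzero (fun k => F (Nat.pair n (prefixCode q k))) t

theorem prefixCode_congr {q q' : ℕ → ℕ} {k : ℕ} (h : ∀ i < k, q i = q' i) :
    prefixCode q k = prefixCode q' k := by
  unfold prefixCode
  congr 1
  exact List.map_congr_left fun i hi => h i (List.mem_range.1 hi)

theorem evalAt_congr {F q q' : ℕ → ℕ} {n t : ℕ} (h : ∀ i < t, q i = q' i) :
    evalAt F q n t = evalAt F q' n t :=
  firstNonzero_congr fun k hk => by rw [prefixCode_congr fun i hi => h i (by omega)]

theorem Applies.evalAt_eq {F q r : ℕ → ℕ} (h : Applies F q r) (n t : ℕ) :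
    evalAt F q n t = 0 ∨ evalAt F q n t = r n + 1 := by
  obtain ⟨k, hk, h0⟩ := h n
  by_cases hkt : k < t
  · exact .inr (firstNonzero_eq hkt hk h0)
  · exact .inl (firstNonzero_eq_zero fun j hj => h0 j (by omega))

theorem Applies.eventually_evalAt {F q r : ℕ → ℕ} (h : Applies F q r) (n : ℕ) :
    ∀ᶠ t in Filter.atTop, evalAt F q n t = r n + 1 := by
  obtain ⟨k, hk, h0⟩ := h n
  filter_upwards [Filter.eventually_gt_atTop k] with t ht
  exact firstNonzero_eq ht hk h0

theorem pair_le_pair_right (a : ℕ) {b c : ℕ} (h : b ≤ c) : Nat.pair a b ≤ Nat.pair a c := by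
  rcases h.eq_or_lt with rfl | h
  · rfl
  · exact (Nat.pair_lt_pair_right a h).le

/-- The sequence `f` with the symbols from position `j` on replaced by `0`. -/
def truncate (f : ℕ → ℕ) (j : ℕ) : ℕ → ℕ := fun x => if x < j then f x else 0

theorem encode_le_encode_append (l l' : List ℕ) :
    Encodable.encode l ≤ Encodable.encode (l ++ l') := by
  induction l with
  | nil => simp
  | cons a l ih =>
    rw [List.cons_append, Encodable.encode_list_cons, Encodable.encode_list_cons]
    exact Nat.succ_le_succ (pair_le_pair_right _ ih)

theorem prefixCode_mono (q : ℕ → ℕ) : Monotone (prefixCode q) := by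
  refine monotone_nat_of_le_succ fun k => ?_
  unfold prefixCode
  rw [List.range_succ, List.map_append]
  exact encode_le_encode_append _ _

/-- Longer prefixes have larger codes. Once the decisive query falls outside the known part of `F`,
so do all later ones. Truncation can thus withhold an answer but never falsify it. -/
theorem Applies.evalAt_truncate_eq {F q r : ℕ → ℕ} (h : Applies F q r) (n t j : ℕ) :
    evalAt (truncate F j) q n t = 0 ∨ evalAt (truncate F j) q n t = r n + 1 := by
  obtain ⟨k, hk, h0⟩ := h n
  have h0' : ∀ i < k, truncate F j (Nat.pair n (prefixCode q i)) = 0 := fun i hi => by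
    simp [truncate, h0 i hi]
  by_cases hj : Nat.pair n (prefixCode q k) < j
  · by_cases hkt : k < t
    · exact .inr (firstNonzero_eq hkt (by simp [truncate, hj, hk]) h0')
    · exact .inl (firstNonzero_eq_zero fun i hi => h0' i (by omega))
  · refine .inl (firstNonzero_eq_zero fun i hi => ?_)
    by_cases hik : i < k
    · exact h0' i hik
    · refine if_neg fun hlt => hj (lt_of_le_of_lt ?_ hlt)
      exact pair_le_pair_right _ (prefixCode_mono q (by omega))

theorem Applies.eventually_evalAt_truncate {F q r : ℕ → ℕ} (h : Applies F q r) (n : ℕ) :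
    ∀ᶠ j in Filter.atTop, evalAt (truncate F j) q n j = r n + 1 := by
  obtain ⟨k, hk, h0⟩ := h n
  filter_upwards [Filter.eventually_gt_atTop k,
    Filter.eventually_gt_atTop (Nat.pair n (prefixCode q k))] with j hj hj'
  exact firstNonzero_eq hj (by simp [truncate, hj', hk]) fun i hi => by simp [truncate, h0 i hi]

theorem computable_evalAt {α : Type*} [Primcodable α] {F q : α → ℕ → ℕ} {n t : α → ℕ}
    (hF : Computable fun x : α × ℕ => F x.1 x.2) (hq : Computable fun x : α × ℕ => q x.1 x.2)
    (hn : Computable n) (ht : Computable t) :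
    Computable fun a => evalAt (F a) (q a) (n a) (t a) := by
  unfold evalAt firstNonzero
  refine computable_natRec
    (h := fun a k v => if v = 0 then F a (Nat.pair (n a) (prefixCode (q a) k)) else v) ht
    (Computable.const 0) ?_
  refine computable_ite (by fun_prop) (hF.comp (f := fun x : α × ℕ => F x.1 x.2)
    (g := fun x : α × ℕ × ℕ => (x.1, Nat.pair (n x.1) (prefixCode (q x.1) x.2.1))) ?_)
    (by fun_prop)
  have := computable_prefixCode (q := fun x : α × ℕ × ℕ => q x.1) (k := fun x => x.2.1)
    (by fun_prop)
    (hq.comp (f := fun x : α × ℕ => q x.1 x.2) (g := fun x : (α × ℕ × ℕ) × ℕ => (x.1.1, x.2))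
      (by fun_prop))
  fun_prop

/-! ### The search for tables

A table `(K, L)` stands for the locally constant random variable that reads the first `K` bits of
`ω`, as the binary representation of `w`, and takes as value the point number `L.getD w 0` of the
dense sequence. -/

/-- The radii of the approximations. -/
noncomputable def rad (n : ℕ) : ℝ := 4 / 2 ^ n

theorem rad_pos (n : ℕ) : 0 < rad n := by unfold rad; positivity

theorem rad_succ (n : ℕ) : rad (n + 1) = rad n / 2 := by
  unfold rad; rw [pow_succ]; field_simp

/-- `v` is the successor of the code of a rational number `x` with `x + 2⁻ᵐ < rad n`. -/
def realBelow (v m n : ℕ) : Bool :=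
  decide (0 < v) &&
    -- Denominators are cleared, and the subtracted part of the rational is moved to the right,
    -- where no truncated subtraction occurs.
    decide ((v - 1).unpair.1 * 2 ^ m * 2 ^ n + ((v - 1).unpair.2.unpair.2 + 1) * 2 ^ n <
      4 * 2 ^ m * ((v - 1).unpair.2.unpair.2 + 1) + (v - 1).unpair.2.unpair.1 * 2 ^ m * 2 ^ n)

/-- `q` and `q'` are seen to name points of distance less than `rad n`. -/
def near (D q q' : ℕ → ℕ) (n t : ℕ) : Bool :=
  existsBelow (fun m => realBelow (evalAt D (interleave q q') m t) m n) t

/-- `w` belongs to the finite set of numbers coded by `a`. -/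
def bit (a w : ℕ) : Bool := decide (a / 2 ^ w % 2 = 1)

/-- `q` is seen to name a point that is near to one of the points of the table with words in the
set coded by `a`. -/
def ballTest (D s : ℕ → ℕ) (n K : ℕ) (L : List ℕ) (a : ℕ) (q : ℕ → ℕ) (t : ℕ) : Bool :=
  existsBelow (fun w => bit a w && near D q (component s (L.getD w 0)) n t) (2 ^ K)

/-- The list with the given code, continued by zeros. -/
def listName (c i : ℕ) : ℕ := (Denumerable.ofNat (List ℕ) c).getD i 0

/-- A name of the union of the balls of radius `rad n` around the points of the table with words
in the set coded by `a`. -/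
def ballName (D s : ℕ → ℕ) (n K : ℕ) (L : List ℕ) (a x : ℕ) : ℕ :=
  -- The test with bound `t` inspects only the first `t` symbols of the point's name, so output
  -- symbol `t` is released as soon as `t` symbols are known.
  if (Denumerable.ofNat (List ℕ) x.unpair.2).length < x.unpair.1 then 0
  else (ballTest D s n K L a (listName x.unpair.2) x.unpair.1).toNat + 1

/-- `v` is the successor of the code of a rational number `h` with `N / 2 ^ K < h + rad n`. -/
def massAbove (v n K N : ℕ) : Bool :=
  decide (0 < v) &&
    decide (N * ((v - 1).unpair.2 + 1) * 2 ^ n <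
      (v - 1).unpair.1 * 2 ^ K * 2 ^ n + 4 * ((v - 1).unpair.2 + 1) * 2 ^ K)

/-- The number of elements below `N` of the set coded by `a`. -/
def bitCount (a N : ℕ) : ℕ := ∑ w ∈ Finset.range N, (bit a w).toNat

/-- For each set of words, the valuation named by `P` is seen to give enough mass to the
neighbourhood of the points of the table with these words. -/
def massTest (D s P : ℕ → ℕ) (n K : ℕ) (L : List ℕ) (t : ℕ) : Bool :=
  forallBelow (fun a => existsBelow (fun m =>
    massAbove (evalAt P (ballName D s n K L a) m t) n K (bitCount a (2 ^ K))) t) (2 ^ 2 ^ K)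

/-- The points of two tables are seen to be near for most words. -/
def closeTest (D s : ℕ → ℕ) (n K : ℕ) (L : List ℕ) (K' : ℕ) (L' : List ℕ) (t : ℕ) : Bool :=
  decide (2 ^ K' * 2 ^ n ≤ 4 * 2 ^ K' + (∑ w ∈ Finset.range (2 ^ K'),
    -- Words have their least significant digit first, so `w % 2 ^ K` is the word of the first `K`
    -- bits.
    (near D (component s (L.getD (w % 2 ^ K) 0)) (component s (L'.getD w 0)) n t).toNat) * 2 ^ n)

/-- The state of the search: the level reached and the table of this level. -/
abbrev State := ℕ × ℕ × List ℕ

/-- The stage `j` of the search: test one candidate for the table of the next level. -/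
def step (D s P : ℕ → ℕ) (j : ℕ) (σ : State) : State :=
  -- Only `j.unpair.1` determines the candidate, so each candidate returns at infinitely many
  -- stages. Its first entry is the number of additional bits to be read.
  bif closeTest D s σ.1 σ.2.1 σ.2.2 (σ.2.1 + (Denumerable.ofNat (ℕ × List ℕ) j.unpair.1).1)
      (Denumerable.ofNat (ℕ × List ℕ) j.unpair.1).2 j &&
    -- The table of level `n` is to be adequate at index `n + 1`, so the candidate for the next
    -- level is tested at `n + 2`. Truncation makes stage `j` depend only on the first `j` input
    -- symbols.
    massTest D s (truncate P j) (σ.1 + 2) (σ.2.1 + (Denumerable.ofNat (ℕ × List ℕ) j.unpair.1).1)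
      (Denumerable.ofNat (ℕ × List ℕ) j.unpair.1).2 j
  then (σ.1 + 1, σ.2.1 + (Denumerable.ofNat (ℕ × List ℕ) j.unpair.1).1,
    (Denumerable.ofNat (ℕ × List ℕ) j.unpair.1).2)
  else σ

/-- The state before the stage `k`. -/
def state (D s P : ℕ → ℕ) (k : ℕ) : State := Nat.rec (0, 0, []) (step D s P) k

/-- The number with the binary digits `q 0, …, q (K - 1)`, the least significant digit first. -/
def wordValue (q : ℕ → ℕ) (K : ℕ) : ℕ := ∑ i ∈ Finset.range K, q i * 2 ^ i

/-- A name of the random variable given by the table `(K, L)`. -/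
def tableName (s : ℕ → ℕ) (K : ℕ) (L : List ℕ) (i : ℕ) : ℕ :=
  if (Denumerable.ofNat (List ℕ) i.unpair.2).length < K then 0
  else component s (L.getD (wordValue (listName i.unpair.2) K) 0) i.unpair.1 + 1

/-- The machine that lists the names of the tables of the levels `5, 6, …`. -/
def machine (D s : ℕ → ℕ) (x : ℕ) : ℕ :=
  -- Levels rise by at most one per stage, so the wanted level cannot be skipped. The zeros given
  -- after it has passed are harmless, since only the first non-zero answer counts.
  if (state D s (listName x.unpair.2) (Denumerable.ofNat (List ℕ) x.unpair.2).length).1 =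
      x.unpair.1.unpair.1 + 5 then
    tableName s
      (state D s (listName x.unpair.2) (Denumerable.ofNat (List ℕ) x.unpair.2).length).2.1
      (state D s (listName x.unpair.2) (Denumerable.ofNat (List ℕ) x.unpair.2).length).2.2
      x.unpair.1.unpair.2 + 1
  else 0

/-! ### Computability of the tests, the search and the machine -/

section Computable

variable {α : Type*} [Primcodable α] {D s : ℕ → ℕ}

@[fun_prop]
theorem computable_listName {c i : α → ℕ} (hc : Computable c) (hi : Computable i) :
    Computable fun a => listName (c a) (i a) := by
  unfold listName; fun_prop

@[fun_prop]
theorem computable_bit {b w : α → ℕ} (hb : Computable b) (hw : Computable w) :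
    Computable fun a => bit (b a) (w a) := by
  unfold bit; fun_prop

@[fun_prop]
theorem computable_realBelow {v m n : α → ℕ} (hv : Computable v) (hm : Computable m)
    (hn : Computable n) : Computable fun a => realBelow (v a) (m a) (n a) := by
  unfold realBelow; fun_prop

@[fun_prop]
theorem computable_massAbove {v n K N : α → ℕ} (hv : Computable v) (hn : Computable n)
    (hK : Computable K) (hN : Computable N) :
    Computable fun a => massAbove (v a) (n a) (K a) (N a) := by
  unfold massAbove; fun_prop

@[fun_prop]
theorem computable_bitCount {b N : α → ℕ} (hb : Computable b) (hN : Computable N) :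
    Computable fun a => bitCount (b a) (N a) :=
  computable_sum_range hN (by fun_prop)

theorem computable_wordValue {q : α → ℕ → ℕ} {K : α → ℕ}
    (hq : Computable fun x : α × ℕ => q x.1 x.2) (hK : Computable K) :
    Computable fun a => wordValue (q a) (K a) :=
  computable_sum_range hK (by fun_prop)

theorem computable_interleave {p q : α → ℕ → ℕ} (hp : Computable fun x : α × ℕ => p x.1 x.2)
    (hq : Computable fun x : α × ℕ => q x.1 x.2) :
    Computable fun x : α × ℕ => interleave (p x.1) (q x.1) x.2 := by
  unfold interleave
  exact computable_ite (by fun_prop)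
    (hp.comp (f := fun x : α × ℕ => p x.1 x.2) (g := fun x : α × ℕ => (x.1, x.2 / 2))
      (by fun_prop))
    (hq.comp (f := fun x : α × ℕ => q x.1 x.2) (g := fun x : α × ℕ => (x.1, x.2 / 2))
      (by fun_prop))

theorem computable_near (hD : Computable D) {q q' : α → ℕ → ℕ} {n t : α → ℕ}
    (hq : Computable fun x : α × ℕ => q x.1 x.2) (hq' : Computable fun x : α × ℕ => q' x.1 x.2)
    (hn : Computable n) (ht : Computable t) :
    Computable fun a => near D (q a) (q' a) (n a) (t a) := by
  refine computable_existsBelow ht (computable_realBelow ?_ (by fun_prop) (by fun_prop))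
  exact computable_evalAt (F := fun _ => D) (q := fun x : α × ℕ => interleave (q x.1) (q' x.1))
    (by fun_prop)
    ((computable_interleave hq hq').comp (f := fun x : α × ℕ => interleave (q x.1) (q' x.1) x.2)
      (g := fun x : (α × ℕ) × ℕ => (x.1.1, x.2)) (by fun_prop))
    (by fun_prop) (by fun_prop)

@[fun_prop]
theorem computable_component (hs : Computable s) {j i : α → ℕ} (hj : Computable j)
    (hi : Computable i) : Computable fun a => component s (j a) (i a) := by
  unfold component; fun_prop

theorem computable_ballTest (hD : Computable D) (hs : Computable s) {n K b t : α → ℕ}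
    {L : α → List ℕ} {q : α → ℕ → ℕ} (hn : Computable n) (hK : Computable K) (hL : Computable L)
    (hb : Computable b) (hq : Computable fun x : α × ℕ => q x.1 x.2) (ht : Computable t) :
    Computable fun a => ballTest D s (n a) (K a) (L a) (b a) (q a) (t a) := by
  refine computable_existsBelow (by fun_prop) (computable_and (by fun_prop) ?_)
  exact computable_near hD (q := fun x : α × ℕ => q x.1)
    (hq.comp (f := fun x : α × ℕ => q x.1 x.2) (g := fun x : (α × ℕ) × ℕ => (x.1.1, x.2))
      (by fun_prop)) (by fun_prop) (by fun_prop) (by fun_prop)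

@[fun_prop]
theorem computable_ballName (hD : Computable D) (hs : Computable s) {n K b x : α → ℕ}
    {L : α → List ℕ} (hn : Computable n) (hK : Computable K) (hL : Computable L)
    (hb : Computable b) (hx : Computable x) :
    Computable fun a => ballName D s (n a) (K a) (L a) (b a) (x a) := by
  have := computable_ballTest hD hs (q := fun a => listName (x a).unpair.2)
    (t := fun a => (x a).unpair.1) hn hK hL hb (by fun_prop) (by fun_prop)
  unfold ballName
  fun_prop

theorem computable_massTest (hD : Computable D) (hs : Computable s) {P : α → ℕ → ℕ}
    {n K t : α → ℕ} {L : α → List ℕ} (hP : Computable fun x : α × ℕ => P x.1 x.2)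
    (hn : Computable n) (hK : Computable K) (hL : Computable L) (ht : Computable t) :
    Computable fun a => massTest D s (P a) (n a) (K a) (L a) (t a) := by
  refine computable_forallBelow (by fun_prop) (computable_existsBelow (by fun_prop)
    (computable_massAbove ?_ (by fun_prop) (by fun_prop) (by fun_prop)))
  exact computable_evalAt (F := fun x : (α × ℕ) × ℕ => P x.1.1)
    (q := fun x : (α × ℕ) × ℕ => ballName D s (n x.1.1) (K x.1.1) (L x.1.1) x.1.2)
    (hP.comp (f := fun x : α × ℕ => P x.1 x.2) (g := fun x : ((α × ℕ) × ℕ) × ℕ => (x.1.1.1, x.2))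
      (by fun_prop)) (by fun_prop) (by fun_prop) (by fun_prop)

theorem computable_closeTest (hD : Computable D) (hs : Computable s) {n K K' t : α → ℕ}
    {L L' : α → List ℕ} (hn : Computable n) (hK : Computable K) (hL : Computable L)
    (hK' : Computable K') (hL' : Computable L') (ht : Computable t) :
    Computable fun a => closeTest D s (n a) (K a) (L a) (K' a) (L' a) (t a) := by
  have := computable_sum_range (t := fun a => 2 ^ K' a) (f := fun a w =>
    (near D (component s ((L a).getD (w % 2 ^ K a) 0)) (component s ((L' a).getD w 0)) (n a)
      (t a)).toNat) (by fun_prop)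
    (computable_toNat (computable_near hD (by fun_prop) (by fun_prop) (by fun_prop) (by fun_prop)))
  unfold closeTest
  fun_prop

theorem computable_truncate {P : α → ℕ → ℕ} {j i : α → ℕ}
    (hP : Computable fun x : α × ℕ => P x.1 x.2) (hj : Computable j) (hi : Computable i) :
    Computable fun a => truncate (P a) (j a) (i a) := by
  have := hP.comp (f := fun x : α × ℕ => P x.1 x.2) (g := fun a => (a, i a)) (by fun_prop)
  unfold truncate
  fun_prop

theorem computable_step (hD : Computable D) (hs : Computable s) {P : α → ℕ → ℕ} {j : α → ℕ}
    {σ : α → State} (hP : Computable fun x : α × ℕ => P x.1 x.2) (hj : Computable j)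
    (hσ : Computable σ) : Computable fun a => step D s (P a) (j a) (σ a) := by
  have he : Computable fun a => (Denumerable.ofNat (ℕ × List ℕ) (j a).unpair.1).1 := by fun_prop
  have hL : Computable fun a => (Denumerable.ofNat (ℕ × List ℕ) (j a).unpair.1).2 := by fun_prop
  have hK : Computable fun a =>
      (σ a).2.1 + (Denumerable.ofNat (ℕ × List ℕ) (j a).unpair.1).1 := by fun_prop
  have hc := computable_closeTest hD hs (n := fun a => (σ a).1) (K := fun a => (σ a).2.1)
    (L := fun a => (σ a).2.2) (by fun_prop) (by fun_prop) (by fun_prop) hK hL hj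
  have ht := computable_truncate (α := α × ℕ) (P := fun x => P x.1) (j := fun x => j x.1)
    (i := fun x => x.2) (hP.comp (f := fun x : α × ℕ => P x.1 x.2)
      (g := fun x : (α × ℕ) × ℕ => (x.1.1, x.2)) (by fun_prop)) (by fun_prop) (by fun_prop)
  have hm := computable_massTest hD hs (P := fun a => truncate (P a) (j a))
    (n := fun a => (σ a).1 + 2) ht (by fun_prop) hK hL hj
  exact computable_cond (computable_and hc hm)
    (Computable.pair (by fun_prop) (Computable.pair hK hL)) hσ

theorem computable_state (hD : Computable D) (hs : Computable s) {P : α → ℕ → ℕ} {k : α → ℕ}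
    (hP : Computable fun x : α × ℕ => P x.1 x.2) (hk : Computable k) :
    Computable fun a => state D s (P a) (k a) :=
  computable_natRec (h := fun a j σ => step D s (P a) j σ) hk (Computable.const _)
    (computable_step hD hs (P := fun x : α × ℕ × State => P x.1)
      (hP.comp (f := fun x : α × ℕ => P x.1 x.2)
        (g := fun x : (α × ℕ × State) × ℕ => (x.1.1, x.2)) (by fun_prop))
      (by fun_prop) (by fun_prop))

@[fun_prop]
theorem computable_tableName (hs : Computable s) {K i : α → ℕ} {L : α → List ℕ}
    (hK : Computable K) (hL : Computable L) (hi : Computable i) :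
    Computable fun a => tableName s (K a) (L a) (i a) := by
  have := computable_wordValue (q := fun a => listName (i a).unpair.2) (K := K) (by fun_prop) hK
  unfold tableName
  fun_prop

theorem computable_machine (hD : Computable D) (hs : Computable s) : Computable (machine D s) := by
  have := computable_state (α := ℕ) hD hs (P := fun x => listName x.unpair.2)
    (k := fun x => (Denumerable.ofNat (List ℕ) x.unpair.2).length) (by fun_prop) (by fun_prop)
  unfold machine
  fun_prop

end Computable

/-! ### Valuations of total mass one -/

section Valuation

variable {X : Type*} [TopologicalSpace X]

/-- The real-valued function underlying a valuation. -/
noncomputable def Valuation.real (ν : Valuation X) (U : Opens X) : ℝ := (ν.toFun U).toReal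

variable {ν : Valuation X}

theorem Valuation.mono (ν : Valuation X) : Monotone ν.toFun := ν.scottContinuous.monotone

theorem Valuation.ne_top (hν : ν.toFun ⊤ = 1) (U : Opens X) : ν.toFun U ≠ ⊤ :=
  ((ν.mono le_top).trans_lt (hν ▸ ENNReal.one_lt_top)).ne

theorem Valuation.real_mono (hν : ν.toFun ⊤ = 1) : Monotone ν.real := fun _ V h =>
  ENNReal.toReal_mono (Valuation.ne_top hν V) (ν.mono h)

theorem Valuation.real_nonneg (ν : Valuation X) (U : Opens X) : 0 ≤ ν.real U :=
  ENNReal.toReal_nonneg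

theorem Valuation.real_bot (ν : Valuation X) : ν.real ⊥ = 0 := by simp [Valuation.real, ν.map_empty]

theorem Valuation.real_top (hν : ν.toFun ⊤ = 1) : ν.real ⊤ = 1 := by simp [Valuation.real, hν]

theorem Valuation.real_le_one (hν : ν.toFun ⊤ = 1) (U : Opens X) : ν.real U ≤ 1 :=
  (Valuation.real_mono hν le_top).trans_eq (Valuation.real_top hν)

theorem Valuation.real_modular (hν : ν.toFun ⊤ = 1) (U V : Opens X) :
    ν.real U + ν.real V = ν.real (U ⊔ V) + ν.real (U ⊓ V) := by
  have h := Valuation.ne_top hν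
  unfold Valuation.real
  rw [← ENNReal.toReal_add (h _) (h _), ν.modular, ENNReal.toReal_add (h _) (h _)]

theorem Valuation.real_add_le_one (hν : ν.toFun ⊤ = 1) {U V : Opens X} (h : U ⊓ V = ⊥) :
    ν.real U + ν.real V ≤ 1 := by
  rw [Valuation.real_modular hν, h, ν.real_bot, add_zero]
  exact Valuation.real_le_one hν _

/-- Scott continuity plays the role of continuity from below of a measure. -/
theorem Valuation.exists_lt_real (hν : ν.toFun ⊤ = 1) {W : ℕ → Opens X} (hW : Monotone W)
    {U : Opens X} (hU : ⨆ n, W n = U) {t : ℝ} (ht : t < ν.real U) : ∃ n, t < ν.real (W n) := by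
  rcases lt_or_ge t 0 with h0 | h0
  · exact ⟨0, h0.trans_le (ν.real_nonneg _)⟩
  have hlub := ν.scottContinuous (Set.range_nonempty W) hW.directed_le.directedOn_range
    (hU ▸ isLUB_iSup)
  have ht' : ENNReal.ofReal t < ν.toFun U := by
    rwa [← ENNReal.ofReal_toReal (Valuation.ne_top hν U), ENNReal.ofReal_lt_ofReal_iff_of_nonneg h0]
  obtain ⟨-, ⟨-, ⟨n, rfl⟩, rfl⟩, hn⟩ := (lt_isLUB_iff hlub).1 ht'
  exact ⟨n, (ENNReal.ofReal_lt_iff_lt_toReal h0 (Valuation.ne_top hν _)).1 hn⟩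

end Valuation

/-! ### Quantization of valuations and Hall matching -/

variable {X : Type*} [MetricSpace X] {ι : Type*}

/-- The union of the balls of radius `r` around the points `c i` with `i ∈ A`. -/
def ballUnion (c : ι → X) (A : Finset ι) (r : ℝ) : Opens X :=
  ⟨⋃ i ∈ A, Metric.ball (c i) r, isOpen_biUnion fun _ _ => Metric.isOpen_ball⟩

theorem mem_ballUnion {c : ι → X} {A : Finset ι} {r : ℝ} {x : X} :
    x ∈ ballUnion c A r ↔ ∃ i ∈ A, dist x (c i) < r := by
  simp [ballUnion, ← SetLike.mem_coe]

theorem ballUnion_mono (c : ι → X) {A B : Finset ι} (h : A ⊆ B) (r : ℝ) :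
    ballUnion c A r ≤ ballUnion c B r := fun x hx => by
  obtain ⟨i, hi, hx⟩ := mem_ballUnion.1 hx
  exact mem_ballUnion.2 ⟨i, h hi, hx⟩

theorem ballUnion_insert [DecidableEq ι] (c : ι → X) (a : ι) (A : Finset ι) (r : ℝ) :
    ballUnion c (insert a A) r = ballUnion c A r ⊔ ballUnion c {a} r := by
  ext x
  simp [mem_ballUnion, or_comm]

variable {ν : Valuation X}

/-- By modularity, a ball adds less mass to a larger union than to a smaller one. The increment over
all earlier balls is therefore at most the increment over the earlier balls from `S`, and the latter
increments telescope. -/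
theorem sum_increments_le (hν : ν.toFun ⊤ = 1) (ξ : ℕ → X) (r : ℝ) (S : Finset ℕ) :
    ∑ j ∈ S, (ν.real (ballUnion ξ (Finset.range (j + 1)) r) -
      ν.real (ballUnion ξ (Finset.range j) r)) ≤ ν.real (ballUnion ξ S r) := by
  induction S using Finset.induction_on_max with
  | empty => simpa using ν.real_nonneg _
  | insert m S hm ih =>
    rw [Finset.sum_insert fun h => (hm m h).false, Finset.range_add_one, ballUnion_insert,
      ballUnion_insert]
    have h1 := Valuation.real_modular hν (ballUnion ξ (Finset.range m) r) (ballUnion ξ {m} r)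
    have h2 := Valuation.real_modular hν (ballUnion ξ S r) (ballUnion ξ {m} r)
    have h3 : ν.real (ballUnion ξ S r ⊓ ballUnion ξ {m} r) ≤
        ν.real (ballUnion ξ (Finset.range m) r ⊓ ballUnion ξ {m} r) :=
      Valuation.real_mono hν (inf_le_inf_right _
        (ballUnion_mono ξ (fun j hj => Finset.mem_range.2 (hm j hj)) r))
    linarith

theorem exists_lt_of_between {h : ℕ → ℕ} (h0 : h 0 = 0) {J i : ℕ} (hi : i < h J) :
    ∃ j < J, h j ≤ i ∧ i < h (j + 1) := by
  induction J with
  | zero => omega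
  | succ J ih =>
    by_cases hJ : i < h J
    · obtain ⟨j, hj, hj'⟩ := ih hJ
      exact ⟨j, by omega, hj'⟩
    · exact ⟨J, by omega, by omega, hi⟩

/-- A valuation is approximated by equidistributed finite sequences of points. -/
theorem exists_quantization (hν : ν.toFun ⊤ = 1) {ξ : ℕ → X} (hξ : DenseRange ξ) {r η : ℝ}
    (hr : 0 < r) (hη : 0 < η) : ∃ N₀ : ℕ, ∀ N ≥ N₀, ∃ g : Fin N → ℕ, ∀ A : Finset (Fin N),
      (A.card : ℝ) ≤ N * (ν.real (ballUnion (fun i => ξ (g i)) A r) + η) := by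
  set W : ℕ → Opens X := fun j => ballUnion ξ (Finset.range j) r with hW
  have hWmono : Monotone W := fun i j hij =>
    ballUnion_mono ξ (Finset.range_subset_range.2 hij) r
  have hWtop : ⨆ j, W j = ⊤ := by
    refine top_le_iff.1 fun x _ => ?_
    obtain ⟨j, hj⟩ := hξ.exists_dist_lt x hr
    exact Opens.mem_iSup.2 ⟨j + 1, mem_ballUnion.2 ⟨j, by simp, hj⟩⟩
  obtain ⟨J, hJ⟩ := Valuation.exists_lt_real hν hWmono hWtop
    (show 1 - η / 2 < ν.real ⊤ by rw [Valuation.real_top hν]; linarith)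
  -- The rounding errors total at most `J + 1`: one for each of at most `J` blocks and one for the
  -- remainder. They must fit into `N * (η / 2)`, the other half of the allowance being spent on the
  -- mass outside the `J` balls.
  obtain ⟨N₀, hN₀⟩ := exists_nat_gt ((J + 1 : ℝ) / (η / 2))
  refine ⟨N₀, fun N hN => ?_⟩
  have hNη : (J + 1 : ℝ) < N * (η / 2) := by
    rw [div_lt_iff₀ (by positivity)] at hN₀
    refine hN₀.trans_le ?_
    gcongr
  -- Block boundaries: the indices from `h j` up to `h (j + 1)` receive the point `ξ j`. Indices
  -- from `h J` on receive an arbitrary point and are counted as error.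
  set h : ℕ → ℕ := fun j => ⌊(N : ℝ) * ν.real (W j)⌋₊ with hh
  have hle : ∀ j, (h j : ℝ) ≤ N * ν.real (W j) := fun j =>
    Nat.floor_le (mul_nonneg (Nat.cast_nonneg _) (ν.real_nonneg _))
  have hlt : ∀ j, (N : ℝ) * ν.real (W j) < h j + 1 := fun j => Nat.lt_floor_add_one _
  have h0 : h 0 = 0 := by
    have : W 0 = ⊥ := by ext x; simp [hW, mem_ballUnion]
    simp [hh, this, ν.real_bot]
  have hmono : Monotone h := fun i j hij => Nat.floor_mono
    (mul_le_mul_of_nonneg_left (Valuation.real_mono hν (hWmono hij)) (Nat.cast_nonneg _))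
  have hg : ∀ i : Fin N, ∃ j, (i : ℕ) < h J → j < J ∧ h j ≤ i ∧ (i : ℕ) < h (j + 1) := fun i => by
    by_cases hi : (i : ℕ) < h J
    · obtain ⟨j, hj⟩ := exists_lt_of_between h0 hi
      exact ⟨j, fun _ => hj⟩
    · exact ⟨0, fun h => absurd h hi⟩
  choose g hg using hg
  refine ⟨g, fun A => ?_⟩
  set S : Finset ℕ := (A.image g).filter (· < J) with hS
  have hsub : A.map Fin.valEmbedding ⊆
      S.biUnion (fun j => Finset.Ico (h j) (h (j + 1))) ∪ Finset.Ico (h J) N := by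
    intro x hx
    obtain ⟨i, hi, rfl⟩ := Finset.mem_map.1 hx
    simp only [Fin.valEmbedding_apply, Finset.mem_union, Finset.mem_biUnion, Finset.mem_Ico]
    by_cases hiJ : (i : ℕ) < h J
    · exact .inl ⟨g i, by simp only [hS, Finset.mem_filter]
                          exact ⟨Finset.mem_image_of_mem g hi, (hg i hiJ).1⟩, (hg i hiJ).2⟩
    · exact .inr ⟨not_lt.1 hiJ, i.2⟩
  have hcard : A.card ≤ ∑ j ∈ S, (h (j + 1) - h j) + (N - h J) := by
    have h1 := (Finset.card_le_card hsub).trans (Finset.card_union_le _ _)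
    rw [Finset.card_map, Nat.card_Ico] at h1
    refine h1.trans (Nat.add_le_add_right (Finset.card_biUnion_le.trans_eq ?_) _)
    simp
  have hhJ : h J ≤ N := by
    have : (h J : ℝ) ≤ N := (hle J).trans
      (mul_le_of_le_one_right (Nat.cast_nonneg _) (Valuation.real_le_one hν _))
    exact_mod_cast this
  have hcard' : (A.card : ℝ) ≤ ∑ j ∈ S, ((h (j + 1) : ℝ) - h j) + (N - h J) := by
    have : (A.card : ℝ) ≤ ((∑ j ∈ S, (h (j + 1) - h j) + (N - h J) : ℕ) : ℝ) := by
      exact_mod_cast hcard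
    rw [Nat.cast_add, Nat.cast_sum, Nat.cast_sub hhJ] at this
    refine this.trans_eq ?_
    congr 1
    exact Finset.sum_congr rfl fun j _ => Nat.cast_sub (hmono (Nat.le_succ j))
  have hsum : ∑ j ∈ S, ((h (j + 1) : ℝ) - h j) ≤ N * ν.real (ballUnion ξ S r) + J := by
    have h1 : ∑ j ∈ S, ((h (j + 1) : ℝ) - h j) ≤
        ∑ j ∈ S, (N * (ν.real (W (j + 1)) - ν.real (W j)) + 1) :=
      Finset.sum_le_sum fun j _ => by linarith [hle (j + 1), hlt j]
    rw [Finset.sum_add_distrib, ← Finset.mul_sum, Finset.sum_const, nsmul_eq_mul, mul_one] at h1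
    have h2 : (S.card : ℝ) ≤ J := by
      have : S ⊆ Finset.range J := fun j hj => Finset.mem_range.2 (Finset.mem_filter.1 hj).2
      exact_mod_cast (Finset.card_le_card this).trans_eq (Finset.card_range J)
    have h3 := mul_le_mul_of_nonneg_left (sum_increments_le hν ξ r S) (Nat.cast_nonneg (α := ℝ) N)
    linarith
  have hU : ν.real (ballUnion ξ S r) ≤ ν.real (ballUnion (fun i => ξ (g i)) A r) := by
    refine Valuation.real_mono hν fun x hx => ?_
    obtain ⟨j, hj, hx⟩ := mem_ballUnion.1 hx
    obtain ⟨i, hi, rfl⟩ := Finset.mem_image.1 (Finset.mem_filter.1 hj).1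
    exact mem_ballUnion.2 ⟨i, hi, hx⟩
  have hN0 : (0 : ℝ) ≤ N := Nat.cast_nonneg N
  have h4 := mul_le_mul_of_nonneg_left hU hN0
  have h5 := mul_le_mul_of_nonneg_left hJ.le hN0
  have h6 := hlt J
  linarith

/-- Rearrangement of an approximation of a valuation, such that it is close to a coarser one. -/
theorem exists_rearrangement (hν : ν.toFun ⊤ = 1) {N : ℕ} {x y : Fin N → X} {r r' η δ : ℝ}
    (hx : ∀ A : Finset (Fin N), (A.card : ℝ) ≤ N * (ν.real (ballUnion x A r) + r))
    (hy : ∀ A : Finset (Fin N), (A.card : ℝ) ≤ N * (ν.real (ballUnion y A r') + η))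
    (hr : 0 < r) (hη : 0 < η) (hδ : r + r' ≤ δ) (hN : N * (r + η) + 1 ≤ N * δ) :
    ∃ σ : Equiv.Perm (Fin N),
      N * (1 - δ) ≤ ((Finset.univ.filter fun w => dist (x w) (y (σ w)) < δ).card : ℝ) := by
  classical
  -- The number of dummy partners, equal to the possible deficit in Hall's condition rounded up.
  set d : ℕ := ⌈(N : ℝ) * (r + η)⌉₊ with hd
  have hd1 : (N : ℝ) * (r + η) ≤ d := Nat.le_ceil _
  have hd2 : (d : ℝ) < N * (r + η) + 1 := Nat.ceil_lt_add_one (by positivity)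
  set T : Fin N → Finset (Fin N) := fun w => Finset.univ.filter fun i => dist (x w) (y i) < δ with hT
  have hhall : ∀ A : Finset (Fin N),
      A.card ≤ (A.biUnion fun w => (T w).disjSum (Finset.univ : Finset (Fin d))).card := by
    intro A
    rcases A.eq_empty_or_nonempty with rfl | ⟨w₀, hw₀⟩
    · simp
    have hsub : (A.biUnion T).disjSum (Finset.univ : Finset (Fin d)) ⊆
        A.biUnion fun w => (T w).disjSum (Finset.univ : Finset (Fin d)) := by
      rintro (i | i) hi
      · obtain ⟨w, hw, hi⟩ := Finset.mem_biUnion.1 (Finset.inl_mem_disjSum.1 hi)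
        exact Finset.mem_biUnion.2 ⟨w, hw, Finset.inl_mem_disjSum.2 hi⟩
      · exact Finset.mem_biUnion.2 ⟨w₀, hw₀, Finset.inr_mem_disjSum.2 (Finset.mem_univ _)⟩
    refine le_trans ?_ (Finset.card_le_card hsub)
    rw [Finset.card_disjSum, Finset.card_univ, Fintype.card_fin]
    -- A common point would bring some `y i` within `r + r' ≤ δ` of some `x w` with `w ∈ A`, making
    -- `i` an admissible partner. Disjointness bounds the two masses by one in total, so adding `hx`
    -- and `hy` gives Hall's condition.
    have hdisj : ballUnion x A r ⊓ ballUnion y (A.biUnion T)ᶜ r' = ⊥ := by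
      ext z
      simp only [Opens.coe_inf, Set.mem_inter_iff, SetLike.mem_coe, mem_ballUnion, Opens.coe_bot,
        Set.mem_empty_iff_false, iff_false, not_and, not_exists]
      rintro ⟨w, hw, hz⟩ i hi hz'
      rw [Finset.mem_compl, Finset.mem_biUnion] at hi
      refine hi ⟨w, hw, Finset.mem_filter.2 ⟨Finset.mem_univ _, ?_⟩⟩
      have := dist_triangle_left (x w) (y i) z
      linarith
    have h1 := Valuation.real_add_le_one hν hdisj
    have h2 := hx A
    have h3 := hy (A.biUnion T)ᶜ
    have h4 : ((A.biUnion T).card : ℝ) + ((A.biUnion T)ᶜ.card : ℝ) = N := by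
      have := Finset.card_add_card_compl (A.biUnion T)
      rw [Fintype.card_fin] at this
      exact_mod_cast this
    have h5 := mul_le_mul_of_nonneg_left h1 (Nat.cast_nonneg (α := ℝ) N)
    have : (A.card : ℝ) ≤ (A.biUnion T).card + d := by linarith
    exact_mod_cast this
  obtain ⟨f, hf, hfT⟩ := (Finset.all_card_le_biUnion_card_iff_exists_injective _).1 hhall
  -- The words matched to genuine partners; at most `d` words are left out. The partial matching on
  -- `s` extends to a permutation.
  set s : Finset (Fin N) := Finset.univ.filter fun w => (f w).isLeft with hs
  have hf' : ∀ w, ∃ i, w ∈ s → f w = .inl i := fun w => by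
    cases h : f w with
    | inl i => exact ⟨i, fun _ => rfl⟩
    | inr i => exact ⟨w, fun hw => by simp [hs, h] at hw⟩
  choose f' hf' using hf'
  have hinj : Set.InjOn f' s := fun a ha b hb hab =>
    hf (by rw [hf' a ha, hf' b hb, hab])
  obtain ⟨σ, hσ⟩ := Finset.exists_equiv_extend_of_card_eq (t := (Finset.univ : Finset (Fin N)))
    (by simp) (s := s) (f := f') (by simp) hinj
  refine ⟨σ.trans (Equiv.subtypeUnivEquiv fun i => Finset.mem_univ i), ?_⟩
  have hsc : (sᶜ).card ≤ d := by
    have hmaps : Set.MapsTo f (sᶜ : Finset (Fin N))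
        ((Finset.univ : Finset (Fin d)).map Function.Embedding.inr : Finset (Fin N ⊕ Fin d)) := by
      intro w hw
      cases h : f w with
      | inl i => simp [hs, h] at hw
      | inr i => simp
    simpa using Finset.card_le_card_of_injOn f hmaps hf.injOn
  have hsub : s ⊆ Finset.univ.filter fun w =>
      dist (x w) (y ((σ.trans (Equiv.subtypeUnivEquiv fun i => Finset.mem_univ i)) w)) < δ := by
    intro w hw
    have h1 := hfT w
    rw [hf' w hw, Finset.inl_mem_disjSum] at h1
    have h2 : ((σ w : Fin N)) = f' w := hσ w hw
    simpa [hT, h2] using h1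
  have h6 := Finset.card_le_card hsub
  have h7 := Finset.card_add_card_compl s
  rw [Fintype.card_fin] at h7
  have h8 : (N : ℝ) ≤ s.card + d := by exact_mod_cast (by omega : N ≤ s.card + d)
  have h9 : (s.card : ℝ) ≤ _ := Nat.cast_le.2 h6
  linarith

/-! ### Correctness of the tests -/

theorem realBelow_zero (m n : ℕ) : realBelow 0 m n = false := by simp [realBelow]

theorem realBelow_succ (c m n : ℕ) :
    realBelow (c + 1) m n = true ↔ (ratOfCode c : ℝ) + (2⁻¹ : ℝ) ^ m < rad n := by
  simp only [realBelow, Nat.succ_pos, decide_true, Bool.true_and, decide_eq_true_eq,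
    Nat.add_sub_cancel]
  unfold ratOfCode rad
  rw [← Nat.cast_lt (α := ℝ)]
  push_cast
  rw [inv_pow, lt_div_iff₀ (by positivity), div_add' _ _ _ (by positivity), div_mul_eq_mul_div,
    div_lt_iff₀ (by positivity), ← sub_pos, ← sub_pos (b := _ * _)]
  have h2 : (0 : ℝ) < 2 ^ m := by positivity
  -- The difference of the natural-number sides is `2 ^ m` times that of the real sides.
  refine Iff.trans (iff_of_eq (congrArg (0 < ·) ?_)) (mul_pos_iff_of_pos_left h2)
  field_simp
  ring

theorem massAbove_zero (n K N : ℕ) : massAbove 0 n K N = false := by simp [massAbove]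

theorem massAbove_succ (c n K N : ℕ) :
    massAbove (c + 1) n K N = true ↔ (N : ℝ) < 2 ^ K * ((nnratOfCode c : ℝ) + rad n) := by
  simp only [massAbove, Nat.succ_pos, decide_true, Bool.true_and, decide_eq_true_eq,
    Nat.add_sub_cancel]
  unfold nnratOfCode rad
  rw [← Nat.cast_lt (α := ℝ)]
  push_cast
  rw [div_add_div _ _ (by positivity) (by positivity), mul_div_assoc', lt_div_iff₀ (by positivity)]
  refine iff_of_eq ?_
  congr 1 <;> ring

theorem existsBelow_iff {f : ℕ → Bool} {t : ℕ} : existsBelow f t = true ↔ ∃ k < t, f k = true := by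
  simp [existsBelow]

theorem forallBelow_iff {f : ℕ → Bool} {t : ℕ} : forallBelow f t = true ↔ ∀ k < t, f k = true := by
  simp [forallBelow]

/-- The elements below `N` of the set coded by `a`. -/
def bitSet (a N : ℕ) : Finset ℕ := (Finset.range N).filter fun w => bit a w = true

theorem bitCount_eq (a N : ℕ) : bitCount a N = (bitSet a N).card := by
  rw [bitCount, bitSet, Finset.card_filter]
  exact Finset.sum_congr rfl fun w _ => by cases bit a w <;> rfl

theorem exists_bitSet_eq {N : ℕ} {A : Finset ℕ} (hA : A ⊆ Finset.range N) :
    ∃ a < 2 ^ N, bitSet a N = A := by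
  refine ⟨Nat.ofBits fun i : Fin N => decide ((i : ℕ) ∈ A), Nat.ofBits_lt_two_pow _, ?_⟩
  ext w
  simp only [bitSet, Finset.mem_filter, Finset.mem_range]
  constructor
  · rintro ⟨hw, h⟩
    rw [bit, ← Nat.testBit_eq_decide_div_mod_eq, Nat.testBit_ofBits_lt _ _ hw] at h
    simpa using h
  · intro h
    have hw := Finset.mem_range.1 (hA h)
    refine ⟨hw, ?_⟩
    rw [bit, ← Nat.testBit_eq_decide_div_mod_eq, Nat.testBit_ofBits_lt _ _ hw]
    simpa using h

theorem lowerNaming.le {r : ℕ → ℕ} {h : ENNReal} (hr : lowerNaming r h) (ht : h ≠ ⊤) (m : ℕ) :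
    (nnratOfCode (r m) : ℝ) ≤ h.toReal := by
  have h1 : ((nnratOfCode (r m) : NNReal) : ENNReal) ≤ h :=
    hr.2 ▸ le_iSup (fun n => ((nnratOfCode (r n) : NNReal) : ENNReal)) m
  have h2 := ENNReal.toReal_mono ht h1
  rwa [ENNReal.coe_toReal] at h2

theorem lowerNaming.exists_lt {r : ℕ → ℕ} {h : ENNReal} (hr : lowerNaming r h) {t : ℝ}
    (hlt : t < h.toReal) : ∃ m, t < (nnratOfCode (r m) : ℝ) := by
  by_contra! hc
  have h0 : 0 ≤ t := le_trans (by positivity) (hc 0)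
  refine hlt.not_ge (ENNReal.toReal_le_of_le_ofReal h0 ?_)
  rw [← hr.2]
  refine iSup_le fun m => ?_
  rw [ENNReal.ofReal, ENNReal.coe_le_coe, ← NNReal.coe_le_coe, Real.coe_toNNReal _ h0]
  exact hc m

theorem listName_prefixCode {q : ℕ → ℕ} {k i : ℕ} (hi : i < k) :
    listName (prefixCode q k) i = q i := by
  simp [listName, prefixCode, List.getD_eq_getElem?_getD, hi]

theorem length_prefixCode (q : ℕ → ℕ) (k : ℕ) :
    (Denumerable.ofNat (List ℕ) (prefixCode q k)).length = k := by
  simp [prefixCode]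

theorem near_congr {D q₁ q₂ q' : ℕ → ℕ} {n t : ℕ} (h : ∀ i < t, q₁ i = q₂ i) :
    near D q₁ q' n t = near D q₂ q' n t := by
  unfold near
  congr 1
  funext m
  congr 1
  refine evalAt_congr fun i hi => ?_
  unfold interleave
  rw [h (i / 2) (by omega)]

/-! ### Soundness and completeness of the tests -/

section Metric

variable {X : Type*} [MetricSpace X] {δ : Representation X} {D s : ℕ → ℕ} {ξ : ℕ → X}

theorem near_sound
    (hD : Realizes (prodNaming δ.Names δ.Names) realNaming D (fun z : X × X => dist z.1 z.2))
    {q q' : ℕ → ℕ} {x y : X} (hq : δ.Names q x) (hq' : δ.Names q' y) {n t : ℕ}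
    (h : near D q q' n t = true) : dist x y < rad n := by
  obtain ⟨r, hr, hrd⟩ := hD (interleave q q') (x, y) ⟨q, q', rfl, hq, hq'⟩
  obtain ⟨m, -, hm⟩ := existsBelow_iff.1 h
  rcases hr.evalAt_eq m t with h0 | h0
  · rw [h0, realBelow_zero] at hm
    exact absurd hm (by simp)
  · rw [h0, realBelow_succ] at hm
    have := (abs_le.1 (hrd m)).2
    linarith

theorem near_eventually
    (hD : Realizes (prodNaming δ.Names δ.Names) realNaming D (fun z : X × X => dist z.1 z.2))
    {q q' : ℕ → ℕ} {x y : X} (hq : δ.Names q x) (hq' : δ.Names q' y) {n : ℕ}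
    (h : dist x y < rad n) : ∀ᶠ t in Filter.atTop, near D q q' n t = true := by
  obtain ⟨r, hr, hrd⟩ := hD (interleave q q') (x, y) ⟨q, q', rfl, hq, hq'⟩
  -- Half the gap, because `2⁻ᵐ` is spent twice: on the error of the approximation and on the safety
  -- margin of the test.
  obtain ⟨m, hm⟩ := exists_pow_lt_of_lt_one (show 0 < (rad n - dist x y) / 2 by linarith)
    (show (2⁻¹ : ℝ) < 1 by norm_num)
  filter_upwards [hr.eventually_evalAt m, Filter.eventually_gt_atTop m] with t ht hmt
  refine existsBelow_iff.2 ⟨m, hmt, ?_⟩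
  rw [ht, realBelow_succ]
  have := (abs_le.1 (hrd m)).1
  simp only at this
  linarith

/-- The point with the word `w` in the table `L`. -/
def tablePoint (ξ : ℕ → X) (L : List ℕ) (w : ℕ) : X := ξ (L.getD w 0)

theorem opensNaming_ballName
    (hD : Realizes (prodNaming δ.Names δ.Names) realNaming D (fun z : X × X => dist z.1 z.2))
    (hs : ∀ n, δ.Names (component s n) (ξ n)) (n K : ℕ) (L : List ℕ) (a : ℕ) :
    opensNaming δ (ballName D s n K L a)
      (ballUnion (tablePoint ξ L) (bitSet a (2 ^ K)) (rad n)) := by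
  intro q x hq
  refine ⟨fun t => (ballTest D s n K L a q t).toNat, fun t => ⟨t, ?_, fun j hj => ?_⟩, ?_⟩
  · have : ballTest D s n K L a (listName (prefixCode q t)) t = ballTest D s n K L a q t := by
      unfold ballTest
      congr 1
      funext w
      rw [near_congr fun i hi => listName_prefixCode hi]
    simp [ballName, length_prefixCode, this]
  · simp [ballName, length_prefixCode, hj]
  · simp only [mem_ballUnion]
    constructor
    · rintro ⟨w, hw, hd⟩
      obtain ⟨hw, hb⟩ := Finset.mem_filter.1 hw
      obtain ⟨t, ht⟩ := (near_eventually hD hq (hs _) hd).exists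
      refine ⟨t, ?_⟩
      have : ballTest D s n K L a q t = true :=
        existsBelow_iff.2 ⟨w, Finset.mem_range.1 hw, by rw [hb, ht]; rfl⟩
      simp [this]
    · rintro ⟨t, ht⟩
      have ht' : ballTest D s n K L a q t = true := by
        by_contra hc
        exact ht (by simp [hc])
      obtain ⟨w, hw, hb⟩ := existsBelow_iff.1 ht'
      rw [Bool.and_eq_true] at hb
      exact ⟨w, Finset.mem_filter.2 ⟨Finset.mem_range.2 hw, hb.1⟩, near_sound hD hq (hs _) hb.2⟩

/-- The valuation gives enough mass to the neighbourhood of each set of points of the table. -/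
def Adequate (ν : Valuation X) (ξ : ℕ → X) (n K : ℕ) (L : List ℕ) : Prop :=
  ∀ A ⊆ Finset.range (2 ^ K),
    (A.card : ℝ) < 2 ^ K * (ν.real (ballUnion (tablePoint ξ L) A (rad n)) + rad n)

variable {p : ℕ → ℕ} {ν : ProbabilityValuation X}

theorem adequate_of_massTest
    (hD : Realizes (prodNaming δ.Names δ.Names) realNaming D (fun z : X × X => dist z.1 z.2))
    (hs : ∀ n, δ.Names (component s n) (ξ n)) (hp : probabilityValuationNaming δ p ν)
    {n K : ℕ} {L : List ℕ} {j t : ℕ} (h : massTest D s (truncate p j) n K L t = true) :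
    Adequate ν.1 ξ n K L := by
  intro A hA
  obtain ⟨a, ha, rfl⟩ := exists_bitSet_eq hA
  obtain ⟨r, hr, hrl⟩ := hp _ _ (opensNaming_ballName hD hs n K L a)
  obtain ⟨m, -, hm⟩ := existsBelow_iff.1 (forallBelow_iff.1 h a ha)
  rcases hr.evalAt_truncate_eq m t j with h0 | h0
  · rw [h0, massAbove_zero] at hm
    exact absurd hm (by simp)
  · rw [h0, massAbove_succ, bitCount_eq] at hm
    refine hm.trans_le ?_
    gcongr
    exact hrl.le (Valuation.ne_top ν.2 _) m

/-- Each of the finitely many inequalities is strict, so some lower approximation of the mass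
already witnesses it, and a long enough part of the name of `ν` yields that approximation. -/
theorem Adequate.eventually_massTest
    (hD : Realizes (prodNaming δ.Names δ.Names) realNaming D (fun z : X × X => dist z.1 z.2))
    (hs : ∀ n, δ.Names (component s n) (ξ n)) (hp : probabilityValuationNaming δ p ν)
    {n K : ℕ} {L : List ℕ} (h : Adequate ν.1 ξ n K L) :
    ∀ᶠ j in Filter.atTop, massTest D s (truncate p j) n K L j = true := by
  have key : ∀ a ∈ Finset.range (2 ^ 2 ^ K), ∀ᶠ j in Filter.atTop, existsBelow (fun m =>
      massAbove (evalAt (truncate p j) (ballName D s n K L a) m j) n K (bitCount a (2 ^ K))) j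
        = true := by
    intro a _
    obtain ⟨r, hr, hrl⟩ := hp _ _ (opensNaming_ballName hD hs n K L a)
    have h1 := h (bitSet a (2 ^ K)) (Finset.filter_subset _ _)
    rw [← div_lt_iff₀' (by positivity), ← sub_lt_iff_lt_add] at h1
    obtain ⟨m, hm⟩ := hrl.exists_lt h1
    filter_upwards [hr.eventually_evalAt_truncate m, Filter.eventually_gt_atTop m] with j hj hmj
    refine existsBelow_iff.2 ⟨m, hmj, ?_⟩
    rw [hj, massAbove_succ, bitCount_eq, ← div_lt_iff₀' (by positivity), ← sub_lt_iff_lt_add]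
    exact hm
  filter_upwards [(Filter.eventually_all_finset _).2 key] with j hj
  exact forallBelow_iff.2 fun a ha => hj a (Finset.mem_range.2 ha)

/-- The words for which the points of two tables are near. -/
noncomputable def closeWords (ξ : ℕ → X) (n K : ℕ) (L : List ℕ) (K' : ℕ) (L' : List ℕ) :
    Finset ℕ := by
  classical
  exact (Finset.range (2 ^ K')).filter fun w =>
    dist (tablePoint ξ L (w % 2 ^ K)) (tablePoint ξ L' w) < rad n

theorem mem_closeWords {n K K' w : ℕ} {L L' : List ℕ} : w ∈ closeWords ξ n K L K' L' ↔
    w < 2 ^ K' ∧ dist (tablePoint ξ L (w % 2 ^ K)) (tablePoint ξ L' w) < rad n := by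
  simp [closeWords]

theorem two_pow_le_iff (K n N : ℕ) :
    2 ^ K * 2 ^ n ≤ 4 * 2 ^ K + N * 2 ^ n ↔ (2 ^ K * (1 - rad n) : ℝ) ≤ N := by
  rw [← Nat.cast_le (α := ℝ)]
  push_cast
  unfold rad
  rw [one_sub_div (by positivity), mul_div_assoc', div_le_iff₀ (by positivity)]
  constructor <;> intro h <;> linarith

theorem card_closeWords_of_closeTest
    (hD : Realizes (prodNaming δ.Names δ.Names) realNaming D (fun z : X × X => dist z.1 z.2))
    (hs : ∀ n, δ.Names (component s n) (ξ n)) {n K K' t : ℕ} {L L' : List ℕ}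
    (h : closeTest D s n K L K' L' t = true) :
    (2 ^ K' * (1 - rad n) : ℝ) ≤ (closeWords ξ n K L K' L').card := by
  rw [closeTest, decide_eq_true_eq, two_pow_le_iff] at h
  refine h.trans (Nat.cast_le.2 ?_)
  calc _ = ((Finset.range (2 ^ K')).filter fun w => near D (component s (L.getD (w % 2 ^ K) 0))
            (component s (L'.getD w 0)) n t = true).card := by
        rw [Finset.card_filter]
        exact Finset.sum_congr rfl fun w _ => by
          cases near D (component s (L.getD (w % 2 ^ K) 0)) (component s (L'.getD w 0)) n t <;> rfl
    _ ≤ _ := Finset.card_le_card fun w hw => by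
        obtain ⟨hw, h⟩ := Finset.mem_filter.1 hw
        exact mem_closeWords.2 ⟨Finset.mem_range.1 hw, near_sound hD (hs _) (hs _) h⟩

theorem eventually_closeTest
    (hD : Realizes (prodNaming δ.Names δ.Names) realNaming D (fun z : X × X => dist z.1 z.2))
    (hs : ∀ n, δ.Names (component s n) (ξ n)) {n K K' : ℕ} {L L' : List ℕ}
    (h : (2 ^ K' * (1 - rad n) : ℝ) ≤ (closeWords ξ n K L K' L').card) :
    ∀ᶠ t in Filter.atTop, closeTest D s n K L K' L' t = true := by
  have key : ∀ w ∈ closeWords ξ n K L K' L', ∀ᶠ t in Filter.atTop,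
      near D (component s (L.getD (w % 2 ^ K) 0)) (component s (L'.getD w 0)) n t = true :=
    fun w hw => near_eventually hD (hs _) (hs _) (mem_closeWords.1 hw).2
  filter_upwards [(Filter.eventually_all_finset _).2 key] with t ht
  rw [closeTest, decide_eq_true_eq, two_pow_le_iff]
  refine h.trans (Nat.cast_le.2 ?_)
  rw [Finset.card_eq_sum_ones]
  refine (Finset.sum_congr rfl fun w hw => by rw [ht w hw]; rfl).trans_le
    (Finset.sum_le_sum_of_subset (fun w hw => Finset.mem_range.2 (mem_closeWords.1 hw).1))

end Metric

/-! ### Progress of the search -/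

section Progress

variable {X : Type*} [MetricSpace X] {δ : Representation X} {D s : ℕ → ℕ} {ξ : ℕ → X}

theorem card_le_mul_card_image_mod {K e : ℕ} (A : Finset (Fin (2 ^ (K + e)))) :
    A.card ≤ 2 ^ e * (A.image fun w : Fin (2 ^ (K + e)) => (w : ℕ) % 2 ^ K).card := by
  refine Finset.card_le_mul_card_image A _ fun a _ => ?_
  rw [← Finset.card_range (2 ^ e)]
  refine Finset.card_le_card_of_injOn (fun w => (w : ℕ) / 2 ^ K) (fun w _ => ?_) ?_
  · simp only [Finset.coe_range, Set.mem_Iio]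
    exact Nat.div_lt_of_lt_mul (by rw [← pow_add]; exact w.2)
  · intro w hw w' hw' h
    simp only [Finset.coe_filter, Set.mem_ofPred_eq] at hw hw' h
    ext
    rw [← Nat.div_add_mod (w : ℕ) (2 ^ K), ← Nat.div_add_mod (w' : ℕ) (2 ^ K), h, hw.2, hw'.2]

/-- Reading `e` further bits and ignoring them keeps adequacy: reduction modulo `2 ^ K` is at most
`2 ^ e` to one and does not change the points. This puts the coarse table on the same index set as a
finer one. -/
theorem Adequate.refine {ν : Valuation X} (hν : ν.toFun ⊤ = 1) {n K : ℕ} {L : List ℕ}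
    (h : Adequate ν ξ n K L) (e : ℕ) (A : Finset (Fin (2 ^ (K + e)))) :
    (A.card : ℝ) ≤ (2 ^ (K + e) : ℕ) *
      (ν.real (ballUnion (fun w : Fin (2 ^ (K + e)) => tablePoint ξ L (w % 2 ^ K)) A (rad n))
        + rad n) := by
  have h1 := h (A.image fun w : Fin (2 ^ (K + e)) => (w : ℕ) % 2 ^ K) fun a ha => by
    obtain ⟨w, -, rfl⟩ := Finset.mem_image.1 ha
    exact Finset.mem_range.2 (Nat.mod_lt _ (by positivity))
  have h2 : ν.real (ballUnion (tablePoint ξ L) (A.image fun w : Fin (2 ^ (K + e)) => (w : ℕ) % 2 ^ K) (rad n)) ≤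
      ν.real (ballUnion (fun w : Fin (2 ^ (K + e)) => tablePoint ξ L (w % 2 ^ K)) A (rad n)) := by
    refine Valuation.real_mono hν fun x hx => ?_
    obtain ⟨a, ha, hx⟩ := mem_ballUnion.1 hx
    obtain ⟨w, hw, rfl⟩ := Finset.mem_image.1 ha
    exact mem_ballUnion.2 ⟨w, hw, hx⟩
  have h3 : (A.card : ℝ) ≤ 2 ^ e * (A.image fun w : Fin (2 ^ (K + e)) => (w : ℕ) % 2 ^ K).card := by
    exact_mod_cast card_le_mul_card_image_mod A
  calc (A.card : ℝ) ≤ 2 ^ e * (2 ^ K * (ν.real (ballUnion (tablePoint ξ L)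
        (A.image fun w : Fin (2 ^ (K + e)) => (w : ℕ) % 2 ^ K) (rad n)) + rad n)) := h3.trans (by gcongr)
    _ = 2 ^ (K + e) * (ν.real (ballUnion (tablePoint ξ L)
        (A.image fun w : Fin (2 ^ (K + e)) => (w : ℕ) % 2 ^ K) (rad n)) + rad n) := by ring
    _ ≤ _ := by push_cast; gcongr

/-- A fine quantization is permuted to match the current table. The permutation does not affect
adequacy, which concerns all sets of words at once. -/
theorem exists_next_table {ν : Valuation X} (hν : ν.toFun ⊤ = 1) (hξ : DenseRange ξ) {n K : ℕ}
    {L : List ℕ} (h : Adequate ν ξ (n + 1) K L) : ∃ (e : ℕ) (L' : List ℕ),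
      (2 ^ (K + e) * (1 - rad n) : ℝ) ≤ (closeWords ξ n K L (K + e) L').card ∧
      Adequate ν ξ (n + 2) (K + e) L' := by
  have hr := rad_pos n
  have hr1 : rad (n + 1) = rad n / 2 := rad_succ n
  have hr2 : rad (n + 2) = rad n / 4 := by rw [rad_succ, rad_succ]; ring
  obtain ⟨N₀, hN₀⟩ := exists_quantization hν hξ (rad_pos (n + 2))
    -- The value `rad n / 8` is below `rad (n + 2) = rad n / 4`, which gives strict adequacy.
    -- Together with `rad (n + 1) = rad n / 2` it leaves `3 / 8` of `N * rad n`, hence at least `9 /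
    -- 8`, for the rounding error one in the matching.
    (show 0 < rad n / 8 by positivity)
  obtain ⟨N₁, hN₁⟩ := exists_nat_gt (3 / rad n)
  obtain ⟨e, he⟩ : ∃ e, N₀ + N₁ < 2 ^ e := ⟨_, Nat.lt_two_pow_self⟩
  have heN : 2 ^ e ≤ 2 ^ (K + e) := Nat.pow_le_pow_right (by norm_num) (by omega)
  obtain ⟨g, hg⟩ := hN₀ (2 ^ (K + e)) (by omega)
  have hN : (3 : ℝ) ≤ (2 ^ (K + e) : ℕ) * rad n := by
    rw [← div_le_iff₀ hr]
    exact hN₁.le.trans (Nat.cast_le.2 (by omega))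
  obtain ⟨σ, hσ⟩ := exists_rearrangement hν (h.refine hν e) hg (rad_pos _)
    (show 0 < rad n / 8 by positivity) (show rad (n + 1) + rad (n + 2) ≤ rad n by linarith)
    (by rw [hr1]; linarith)
  have hL : ∀ w : Fin (2 ^ (K + e)),
      tablePoint ξ (List.ofFn fun w => g (σ w)) w = ξ (g (σ w)) := fun w => by
    simp [tablePoint, List.getD_eq_getElem?_getD]
  refine ⟨e, List.ofFn fun w => g (σ w), ?_, fun A hA => ?_⟩
  · push_cast at hσ
    refine hσ.trans (Nat.cast_le.2 ?_)
    rw [← Finset.card_map Fin.valEmbedding]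
    refine Finset.card_le_card fun w hw => ?_
    obtain ⟨i, hi, rfl⟩ := Finset.mem_map.1 hw
    refine mem_closeWords.2 ⟨i.2, ?_⟩
    rw [Fin.valEmbedding_apply, hL]
    exact (Finset.mem_filter.1 hi).2
  · set B : Finset (Fin (2 ^ (K + e))) := Finset.univ.filter fun w => (w : ℕ) ∈ A with hB
    have hBA : B.map Fin.valEmbedding = A := by
      ext w
      constructor
      · intro hw
        obtain ⟨i, hi, rfl⟩ := Finset.mem_map.1 hw
        exact (Finset.mem_filter.1 hi).2
      · intro hw
        exact Finset.mem_map.2 ⟨⟨w, Finset.mem_range.1 (hA hw)⟩, by simp [hB, hw], rfl⟩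
    have h1 := hg (B.map σ.toEmbedding)
    have h2 : ν.real (ballUnion (fun i => ξ (g i)) (B.map σ.toEmbedding) (rad (n + 2))) ≤
        ν.real (ballUnion (tablePoint ξ (List.ofFn fun w => g (σ w))) A (rad (n + 2))) := by
      refine Valuation.real_mono hν fun x hx => ?_
      obtain ⟨i, hi, hx⟩ := mem_ballUnion.1 hx
      obtain ⟨w, hw, rfl⟩ := Finset.mem_map.1 hi
      exact mem_ballUnion.2 ⟨w, (Finset.mem_filter.1 hw).2, by rw [hL]; exact hx⟩
    rw [Finset.card_map, ← Finset.card_map Fin.valEmbedding, hBA] at h1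
    push_cast at h1
    refine h1.trans_lt (mul_lt_mul_of_pos_left ?_ (by positivity))
    linarith

/-- The tests of the stage `j` for the candidate of this stage. -/
def stepTest (D s P : ℕ → ℕ) (j : ℕ) (σ : State) (c : ℕ × List ℕ) : Prop :=
  closeTest D s σ.1 σ.2.1 σ.2.2 (σ.2.1 + c.1) c.2 j = true ∧
    massTest D s (truncate P j) (σ.1 + 2) (σ.2.1 + c.1) c.2 j = true

/-! ### Stages and levels of the search -/

theorem step_of_stepTest {P : ℕ → ℕ} {j : ℕ} {σ : State}
    (h : stepTest D s P j σ (Denumerable.ofNat (ℕ × List ℕ) j.unpair.1)) :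
    step D s P j σ = (σ.1 + 1, σ.2.1 + (Denumerable.ofNat (ℕ × List ℕ) j.unpair.1).1,
      (Denumerable.ofNat (ℕ × List ℕ) j.unpair.1).2) := by
  rw [step, h.1, h.2]; rfl

theorem step_cases (D s P : ℕ → ℕ) (j : ℕ) (σ : State) :
    step D s P j σ = σ ∨ ∃ c, stepTest D s P j σ c ∧
      step D s P j σ = (σ.1 + 1, σ.2.1 + c.1, c.2) := by
  by_cases h : stepTest D s P j σ (Denumerable.ofNat (ℕ × List ℕ) j.unpair.1)
  · exact .inr ⟨_, h, step_of_stepTest h⟩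
  · left
    rw [stepTest, ← Bool.and_eq_true, Bool.not_eq_true] at h
    rw [step, h]; rfl

theorem state_succ (D s P : ℕ → ℕ) (k : ℕ) :
    state D s P (k + 1) = step D s P k (state D s P k) := rfl

theorem truncate_congr {P P' : ℕ → ℕ} {j : ℕ} (h : ∀ i < j, P i = P' i) :
    truncate P j = truncate P' j := by
  funext i
  unfold truncate
  split_ifs with hi
  · exact h i hi
  · rfl

theorem state_congr {P P' : ℕ → ℕ} {k : ℕ} (h : ∀ i < k, P i = P' i) :
    state D s P k = state D s P' k := by
  induction k with
  | zero => rfl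
  | succ k ih =>
    rw [state_succ, state_succ, ih fun i hi => h i (by omega)]
    unfold step
    rw [truncate_congr fun i (hi : i < k) => h i (by omega)]

theorem level_mono (D s P : ℕ → ℕ) : Monotone fun k => (state D s P k).1 := by
  refine monotone_nat_of_le_succ fun k => ?_
  rw [state_succ]
  rcases step_cases D s P k (state D s P k) with h | ⟨c, -, h⟩ <;> rw [h]
  exact Nat.le_succ _

/-- The state changes only when the level rises. -/
theorem state_eq_of_level_eq {P : ℕ → ℕ} {j k : ℕ} (hjk : j ≤ k)
    (h : (state D s P j).1 = (state D s P k).1) : state D s P j = state D s P k := by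
  induction k, hjk using Nat.le_induction with
  | base => rfl
  | succ k hjk ih =>
    have h1 : (state D s P j).1 ≤ (state D s P k).1 := level_mono D s P hjk
    rw [state_succ] at h ⊢
    rcases step_cases D s P k (state D s P k) with h2 | ⟨c, -, h2⟩ <;> rw [h2] at h ⊢
    · exact ih h
    · simp only at h
      omega

variable {p : ℕ → ℕ} {ν : ProbabilityValuation X}

/-- Since `rad 1 = 2` exceeds the total mass, the condition is void. The search can therefore start
from the empty table, whose only value is `ξ 0`. -/
theorem adequate_one (ν : Valuation X) (K : ℕ) (L : List ℕ) : Adequate ν ξ 1 K L := by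
  intro A hA
  have h1 : (A.card : ℝ) ≤ 2 ^ K := by
    exact_mod_cast (Finset.card_le_card hA).trans_eq (Finset.card_range _)
  have h2 : rad 1 = 2 := by norm_num [rad]
  have h3 : (0 : ℝ) < 2 ^ K := by positivity
  rw [h2]
  nlinarith [ν.real_nonneg (ballUnion (tablePoint ξ L) A 2)]

theorem adequate_state
    (hD : Realizes (prodNaming δ.Names δ.Names) realNaming D (fun z : X × X => dist z.1 z.2))
    (hs : ∀ n, δ.Names (component s n) (ξ n)) (hp : probabilityValuationNaming δ p ν) (k : ℕ) :
    Adequate ν.1 ξ ((state D s p k).1 + 1) (state D s p k).2.1 (state D s p k).2.2 := by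
  induction k with
  | zero => exact adequate_one ν.1 _ _
  | succ k ih =>
    rw [state_succ]
    rcases step_cases D s p k (state D s p k) with h | ⟨c, hc, h⟩ <;> rw [h]
    · exact ih
    · exact adequate_of_massTest hD hs hp hc.2

/-- If the search were stuck, its state would be constant from some stage on. A suitable next table
exists, its tests eventually succeed for good, and it is proposed again at a later stage. -/
theorem exists_level
    (hD : Realizes (prodNaming δ.Names δ.Names) realNaming D (fun z : X × X => dist z.1 z.2))
    (hs : ∀ n, δ.Names (component s n) (ξ n)) (hξ : DenseRange ξ)
    (hp : probabilityValuationNaming δ p ν) (n : ℕ) : ∃ k, (state D s p k).1 = n := by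
  induction n with
  | zero => exact ⟨0, rfl⟩
  | succ n ih =>
    obtain ⟨k, hk⟩ := ih
    by_contra! hc
    have hconst : ∀ j ≥ k, state D s p j = state D s p k := fun j hj => by
      induction j, hj using Nat.le_induction with
      | base => rfl
      | succ j hj ih =>
        rw [state_succ, ih]
        rcases step_cases D s p j (state D s p k) with h | ⟨c, -, h⟩
        · exact h
        · exact absurd (by rw [state_succ, ih, h, hk]) (hc (j + 1))
    have hA := adequate_state hD hs hp k
    obtain ⟨e, L', h1, h2⟩ := exists_next_table ν.2 hξ hA
    have hev := (eventually_closeTest hD hs h1).and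
      ((Filter.eventually_ge_atTop k).and (h2.eventually_massTest hD hs hp))
    obtain ⟨N, hN⟩ := Filter.eventually_atTop.1 hev
    -- The second component is padding that makes the stage at least `N`.
    have hj := hN (Nat.pair (Encodable.encode (e, L')) N) (Nat.right_le_pair _ _)
    set j := Nat.pair (Encodable.encode (e, L')) N with hjdef
    have hcand : Denumerable.ofNat (ℕ × List ℕ) j.unpair.1 = (e, L') := by
      rw [hjdef, Nat.unpair_pair, Denumerable.ofNat_encode]
    have ht : stepTest D s p j (state D s p k) (Denumerable.ofNat (ℕ × List ℕ) j.unpair.1) := by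
      rw [hcand]; exact ⟨hj.1, hj.2.2⟩
    refine hc (j + 1) ?_
    rw [state_succ, hconst j hj.2.1, step_of_stepTest ht, hk]

/-- The search passes through all levels, and each table is adequate and close to the previous
one. -/
theorem exists_tables
    (hD : Realizes (prodNaming δ.Names δ.Names) realNaming D (fun z : X × X => dist z.1 z.2))
    (hs : ∀ n, δ.Names (component s n) (ξ n)) (hξ : DenseRange ξ)
    (hp : probabilityValuationNaming δ p ν) : ∃ (K : ℕ → ℕ) (L : ℕ → List ℕ),
      (∀ n, ∃ k, state D s p k = (n, K n, L n) ∧ ∀ j < k, (state D s p j).1 ≠ n) ∧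
      (∀ n, Adequate ν.1 ξ (n + 1) (K n) (L n)) ∧
      (∀ n, K n ≤ K (n + 1)) ∧
      (∀ n, (2 ^ K (n + 1) * (1 - rad n) : ℝ) ≤
        (closeWords ξ n (K n) (L n) (K (n + 1)) (L (n + 1))).card) := by
  classical
  have hex := exists_level hD hs hξ hp
  set κ : ℕ → ℕ := fun n => Nat.find (hex n) with hκ
  have hlev : ∀ n, (state D s p (κ n)).1 = n := fun n => Nat.find_spec (hex n)
  have hmin : ∀ n, ∀ j < κ n, (state D s p j).1 ≠ n := fun n j hj => Nat.find_min (hex n) hj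
  have hsucc : ∀ n, ∃ (j : ℕ) (c : ℕ × List ℕ), stepTest D s p j (state D s p (κ n)) c ∧
      state D s p (κ (n + 1)) = (n + 1, (state D s p (κ n)).2.1 + c.1, c.2) := by
    intro n
    obtain ⟨j, hj⟩ : ∃ j, κ (n + 1) = j + 1 := Nat.exists_eq_succ_of_ne_zero fun h0 => by
      have := hlev (n + 1)
      rw [h0] at this
      exact absurd this (Nat.succ_ne_zero n).symm
    have h1 := hlev (n + 1)
    have h2 := hmin (n + 1) j (by omega)
    rw [hj, state_succ] at h1
    rw [hj, state_succ]
    rcases step_cases D s p j (state D s p j) with h | ⟨c, hc, h⟩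
    · rw [h] at h1
      exact absurd h1 h2
    · rw [h] at h1 ⊢
      have hjn : (state D s p j).1 = n := Nat.succ_injective h1
      have hle : κ n ≤ j := Nat.find_min' (hex n) hjn
      -- The successful test took place at stage `j`, possibly long after level `n` was reached, but
      -- against the same table.
      have heq : state D s p (κ n) = state D s p j :=
        state_eq_of_level_eq hle ((hlev n).trans hjn.symm)
      refine ⟨j, c, heq ▸ hc, ?_⟩
      rw [heq, hjn]
  refine ⟨fun n => (state D s p (κ n)).2.1, fun n => (state D s p (κ n)).2.2,
    fun n => ⟨κ n, ?_, hmin n⟩, fun n => ?_, fun n => ?_, fun n => ?_⟩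
  · exact Prod.ext (hlev n) rfl
  · have := adequate_state hD hs hp (κ n)
    rwa [hlev n] at this
  · obtain ⟨j, c, -, h⟩ := hsucc n
    simp only [h]
    omega
  · obtain ⟨j, c, hc, h⟩ := hsucc n
    have := card_closeWords_of_closeTest hD hs hc.1
    rw [hlev n] at this
    simpa only [h] using this

end Progress

/-! ### The random variables given by tables -/

/-- The number with the binary digits `ω 0, …, ω (K - 1)`. -/
def word (ω : ℕ → Bool) (K : ℕ) : ℕ := wordValue (fun i => (ω i).toNat) K

theorem word_succ (ω : ℕ → Bool) (K : ℕ) : word ω (K + 1) = word ω K + (ω K).toNat * 2 ^ K :=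
  Finset.sum_range_succ _ _

theorem word_lt (ω : ℕ → Bool) (K : ℕ) : word ω K < 2 ^ K := by
  induction K with
  | zero => simp [word, wordValue]
  | succ K ih =>
    rw [word_succ, pow_succ]
    have := Nat.mul_le_mul_right (2 ^ K) (Bool.toNat_le (ω K))
    omega

theorem word_mod (ω : ℕ → Bool) {K K' : ℕ} (h : K ≤ K') : word ω K' % 2 ^ K = word ω K := by
  induction K', h using Nat.le_induction with
  | base => exact Nat.mod_eq_of_lt (word_lt ω K)
  | succ K' h ih =>
    have h2 : 2 ^ K ∣ (ω K').toNat * 2 ^ K' := Dvd.dvd.mul_left (pow_dvd_pow 2 h) _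
    rw [word_succ, Nat.add_mod, ih, Nat.mod_eq_zero_of_dvd h2, add_zero,
      Nat.mod_eq_of_lt (word_lt ω K)]

theorem word_eq_iff {ω : ℕ → Bool} {K w : ℕ} (hw : w < 2 ^ K) :
    word ω K = w ↔ ∀ i < K, ω i = w.testBit i := by
  induction K generalizing w with
  | zero => simp_all [word, wordValue]
  | succ K ih =>
    have hdiv : w / 2 ^ K < 2 := Nat.div_lt_of_lt_mul (by rwa [← pow_succ])
    have h1 : word ω (K + 1) = w ↔ word ω K = w % 2 ^ K ∧ (ω K).toNat = w / 2 ^ K := by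
      rw [word_succ]
      constructor
      · rintro rfl
        rw [Nat.add_mul_mod_self_right, Nat.add_mul_div_right _ _ (by positivity),
          Nat.mod_eq_of_lt (word_lt ω K), Nat.div_eq_of_lt (word_lt ω K), zero_add]
        exact ⟨rfl, rfl⟩
      · rintro ⟨h1, h2⟩
        rw [h1, h2, mul_comm, Nat.mod_add_div]
    have h2 : (ω K).toNat = w / 2 ^ K ↔ ω K = w.testBit K := by
      rw [Nat.testBit_eq_decide_div_mod_eq, Nat.mod_eq_of_lt hdiv]
      generalize w / 2 ^ K = d at hdiv
      interval_cases d <;> cases ω K <;> simp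
    rw [h1, ih (Nat.mod_lt _ (by positivity)), h2]
    simp only [Nat.testBit_mod_two_pow, Nat.forall_lt_succ_right]
    refine and_congr_left fun _ => forall_congr' fun i => imp_congr_right fun hi => ?_
    simp [hi]

theorem continuous_word (K : ℕ) : Continuous fun ω => word ω K := by
  unfold word wordValue
  exact continuous_finsetSum _ fun i _ =>
    (continuous_of_discreteTopology (f := fun b : Bool => b.toNat * 2 ^ i)).comp
      (continuous_apply i)

theorem coinMeasure_word_eq {K w : ℕ} (hw : w < 2 ^ K) :
    coinMeasure.real {ω | word ω K = w} = (2 ^ K : ℝ)⁻¹ := by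
  have h : {ω : ℕ → Bool | word ω K = w} =
      Set.pi (Finset.range K) (fun i => {w.testBit i}) := by
    ext ω
    simp [word_eq_iff hw, Set.mem_pi]
  rw [h, Measure.real, coinMeasure, Measure.infinitePi_pi _ fun i _ => measurableSet_singleton _]
  simp

theorem coinMeasure_word_mem {K : ℕ} {A : Finset ℕ} (hA : A ⊆ Finset.range (2 ^ K)) :
    coinMeasure.real {ω | word ω K ∈ A} = A.card / 2 ^ K := by
  have h : {ω : ℕ → Bool | word ω K ∈ A} = ⋃ w ∈ A, {ω | word ω K = w} := by
    ext ω; simp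
  rw [h, measureReal_biUnion_finset]
  · rw [Finset.sum_congr rfl fun w hw => coinMeasure_word_eq (Finset.mem_range.1 (hA hw)),
      Finset.sum_const, nsmul_eq_mul, div_eq_mul_inv]
  · intro a _ b _ hab
    exact Set.disjoint_left.2 fun ω (h1 : word ω K = a) (h2 : word ω K = b) => hab (h1 ▸ h2)
  · exact fun w _ => (continuous_word K).measurable (measurableSet_singleton w)

/-! ### Table random variables, the Fan metric and adequacy -/

section

variable {X : Type*} [MetricSpace X] {δ : Representation X} {s : ℕ → ℕ} {ξ : ℕ → X}

/-- The random variable given by a table. -/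
def tableRV (ξ : ℕ → X) (K : ℕ) (L : List ℕ) : ContinuousRV X :=
  ⟨⟨fun ω => tablePoint ξ L (word ω K),
    (continuous_of_discreteTopology (f := tablePoint ξ L)).comp (continuous_word K)⟩⟩

theorem continuousRVNaming_tableName (hs : ∀ n, δ.Names (component s n) (ξ n)) (K : ℕ)
    (L : List ℕ) : continuousRVNaming δ (tableName s K L) (tableRV ξ K L) := by
  intro q ω hq
  refine ⟨component s (L.getD (word ω K) 0), fun n => ⟨K, ?_, fun j hj => ?_⟩, hs _⟩
  · have h : wordValue (listName (prefixCode q K)) K = word ω K :=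
      Finset.sum_congr rfl fun i hi => by
        rw [listName_prefixCode (Finset.mem_range.1 hi), hq i]
    simp [tableName, length_prefixCode, h]
  · simp [tableName, length_prefixCode, hj]

theorem fanDist_le {Y Z : ContinuousRV X} {r : ℝ} (hr : 0 ≤ r)
    (h : coinMeasure.real {ω | r ≤ dist (Y.map ω) (Z.map ω)} ≤ r) : dist Y Z ≤ r := by
  refine Real.sSup_le (fun ε hε => ?_) hr
  by_contra! hlt
  have h1 : coinMeasure.real {ω | ε < dist (Y.map ω) (Z.map ω)} ≤
      coinMeasure.real {ω | r ≤ dist (Y.map ω) (Z.map ω)} :=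
    measureReal_mono fun ω (hω : ε < _) => hlt.le.trans hω.le
  exact (hε.2.trans_le (h1.trans h)).not_gt hlt

/-- Both variables are functions of the first `K'` bits, and at most a fraction `rad n` of these
words gives points at distance `rad n` or more. -/
theorem dist_tableRV_le {n K K' : ℕ} {L L' : List ℕ} (hK : K ≤ K')
    (h : (2 ^ K' * (1 - rad n) : ℝ) ≤ (closeWords ξ n K L K' L').card) :
    dist (tableRV ξ K L) (tableRV ξ K' L') ≤ rad n := by
  refine fanDist_le (rad_pos n).le ?_
  have hsub : closeWords ξ n K L K' L' ⊆ Finset.range (2 ^ K') := fun w hw =>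
    Finset.mem_range.2 (mem_closeWords.1 hw).1
  have h1 : {ω | rad n ≤ dist ((tableRV ξ K L).map ω) ((tableRV ξ K' L').map ω)} ⊆
      {ω | word ω K' ∈ closeWords ξ n K L K' L'}ᶜ := by
    intro ω hω hmem
    have := (mem_closeWords.1 hmem).2
    rw [word_mod ω hK] at this
    exact this.not_ge hω
  refine (measureReal_mono h1).trans ?_
  have hm : MeasurableSet {ω | word ω K' ∈ closeWords ξ n K L K' L'} :=
    (continuous_word K').measurable (Finset.measurableSet _)
  rw [probReal_compl_eq_one_sub hm, coinMeasure_word_mem hsub, sub_le_comm,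
    le_div_iff₀' (by positivity)]
  exact h

variable {ν : Valuation X} {n K : ℕ} {L : List ℕ}

theorem Adequate.measure_word_le (h : Adequate ν ξ n K L) {A : Finset ℕ}
    (hA : A ⊆ Finset.range (2 ^ K)) : coinMeasure.real {ω | word ω K ∈ A} ≤
      ν.real (ballUnion (tablePoint ξ L) A (rad n)) + rad n := by
  rw [coinMeasure_word_mem hA, div_le_iff₀' (by positivity)]
  exact (h A hA).le

theorem Adequate.measure_ball_subset_le (h : Adequate ν ξ n K L) (hν : ν.toFun ⊤ = 1)
    (U : Opens X) :
    coinMeasure.real {ω | Metric.ball ((tableRV ξ K L).map ω) (rad n) ⊆ U} ≤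
      ν.real U + rad n := by
  classical
  set A := (Finset.range (2 ^ K)).filter fun w =>
    Metric.ball (tablePoint ξ L w) (rad n) ⊆ (U : Set X) with hA
  have h1 : {ω | Metric.ball ((tableRV ξ K L).map ω) (rad n) ⊆ (U : Set X)} ⊆
      {ω | word ω K ∈ A} := fun ω hω =>
    Finset.mem_filter.2 ⟨Finset.mem_range.2 (word_lt ω K), hω⟩
  refine (measureReal_mono h1).trans ((h.measure_word_le (Finset.filter_subset _ _)).trans ?_)
  gcongr
  refine Valuation.real_mono hν fun x hx => ?_
  obtain ⟨w, hw, hx⟩ := mem_ballUnion.1 hx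
  exact (Finset.mem_filter.1 hw).2 hx

/-- The lower bound comes from the complement: the neighbourhood of the table points outside `V`
misses `W`, so its mass is at most `1 - ν(W)`, and adequacy bounds the probability of these points.
-/
theorem Adequate.le_measure_mem (h : Adequate ν ξ n K L) (hν : ν.toFun ⊤ = 1) {V W : Opens X}
    (hVW : ∀ x ∈ W, Metric.ball x (rad n) ⊆ V) :
    ν.real W ≤ coinMeasure.real {ω | (tableRV ξ K L).map ω ∈ V} + rad n := by
  classical
  set A := (Finset.range (2 ^ K)).filter fun w => tablePoint ξ L w ∉ V with hA
  have h1 := h.measure_word_le (A := A) (Finset.filter_subset _ _)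
  have h2 : (1 : ℝ) ≤ coinMeasure.real {ω | word ω K ∈ A} +
      coinMeasure.real {ω | (tableRV ξ K L).map ω ∈ V} := by
    rw [← probReal_univ (μ := coinMeasure)]
    refine (measureReal_mono fun ω _ => ?_).trans (measureReal_union_le _ _)
    by_cases hω : (tableRV ξ K L).map ω ∈ V
    · exact .inr hω
    · exact .inl (Finset.mem_filter.2 ⟨Finset.mem_range.2 (word_lt ω K), hω⟩)
  have h3 : ballUnion (tablePoint ξ L) A (rad n) ⊓ W = ⊥ := by
    ext x
    simp only [Opens.coe_inf, Set.mem_inter_iff, SetLike.mem_coe, mem_ballUnion, Opens.coe_bot,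
      Set.mem_empty_iff_false, iff_false, not_and]
    rintro ⟨w, hw, hx⟩ hxW
    exact (Finset.mem_filter.1 hw).2 (hVW x hxW (by rwa [Metric.mem_ball, dist_comm]))
  have h4 := Valuation.real_add_le_one hν h3
  linarith

/-! ### The distribution of the limit -/

/-- `I_ε(U)` as an open set. -/
def shrinkOpens (ε : ℝ) (U : Opens X) : Opens X where
  carrier := shrink ε (U : Set X)
  is_open' := by
    refine Metric.isOpen_iff.2 fun x hx => ?_
    obtain ⟨hxU, η, hη, hball⟩ := hx
    obtain ⟨ρ, hρ, hρU⟩ := Metric.isOpen_iff.1 U.isOpen x hxU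
    refine ⟨min ρ (η / 2), by positivity, fun y hy => ?_⟩
    rw [Metric.mem_ball, lt_min_iff] at hy
    refine ⟨hρU hy.1, η / 2, by positivity, fun z hz => hball ?_⟩
    rw [Metric.mem_ball] at hz ⊢
    linarith [dist_triangle z y x, hy.2]

theorem mem_shrinkOpens {ε : ℝ} {U : Opens X} {x : X} :
    x ∈ shrinkOpens ε U ↔ x ∈ U ∧ ∃ η > 0, Metric.ball x (ε + η) ⊆ (U : Set X) := Iff.rfl

theorem shrinkOpens_anti (U : Opens X) : Antitone fun ε => shrinkOpens ε U := by
  intro ε ε' h x hx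
  obtain ⟨hxU, η, hη, hball⟩ := mem_shrinkOpens.1 hx
  exact mem_shrinkOpens.2 ⟨hxU, η, hη, (Metric.ball_subset_ball (by linarith)).trans hball⟩

theorem iSup_shrinkOpens (U : Opens X) : ⨆ k : ℕ, shrinkOpens (1 / ((k : ℝ) + 1)) U = U := by
  refine le_antisymm (iSup_le fun k x hx => (mem_shrinkOpens.1 hx).1) fun x hx => ?_
  obtain ⟨ρ, hρ, hρU⟩ := Metric.isOpen_iff.1 U.isOpen x hx
  obtain ⟨k, hk⟩ := exists_nat_one_div_lt (show 0 < ρ / 2 by positivity)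
  exact Opens.mem_iSup.2 ⟨k, mem_shrinkOpens.2 ⟨hx, ρ / 2, by positivity,
    (Metric.ball_subset_ball (by linarith)).trans hρU⟩⟩

theorem exists_lt_real_shrinkOpens (hν : ν.toFun ⊤ = 1) (U : Opens X) {θ : ℝ} (hθ : 0 < θ) :
    ∃ ε : ℚ, 0 < ε ∧ (ε : ℝ) < θ ∧ ν.real U - θ < ν.real (shrinkOpens (2 * ε) U) := by
  have hmono : Monotone fun k : ℕ => shrinkOpens (1 / ((k : ℝ) + 1)) U := fun i j hij =>
    shrinkOpens_anti U (one_div_le_one_div_of_le (by positivity) (by gcongr))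
  obtain ⟨k, hk⟩ := Valuation.exists_lt_real hν hmono (iSup_shrinkOpens U)
    (show ν.real U - θ < ν.real U by linarith)
  have hpos : (0 : ℝ) < 1 / ((k : ℝ) + 1) := by positivity
  -- Halving ensures `2 * ε < 1 / (k + 1)`; the factor two leaves room for shrinking twice.
  obtain ⟨ε, hε0, hε⟩ := exists_rat_btwn (show (0 : ℝ) < min θ (1 / ((k : ℝ) + 1) / 2) by positivity)
  rw [lt_min_iff] at hε
  exact ⟨ε, by exact_mod_cast hε0, hε.1,
    hk.trans_le (Valuation.real_mono hν (shrinkOpens_anti U (by linarith)))⟩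

theorem tendsto_rad : Filter.Tendsto rad Filter.atTop (𝓝 0) := by
  have := (tendsto_pow_atTop_nhds_zero_of_lt_one (r := (2⁻¹ : ℝ)) (by norm_num)
    (by norm_num)).const_mul 4
  simp only [mul_zero] at this
  exact this.congr fun n => by rw [rad, inv_pow, div_eq_mul_inv]

/-- For the upper bound, a competitor `Y` is compared with a late table, whose balls lie in `U`
whenever `Y` lies in `V` with some margin and is not far from the table. For the lower bound, a late
table is itself the competitor. -/
theorem distribution_eq (hν : ν.toFun ⊤ = 1) {m : ℕ → ℕ}
    (hm : Filter.Tendsto m Filter.atTop Filter.atTop) {K : ℕ → ℕ} {L : ℕ → List ℕ}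
    (hA : ∀ n, Adequate ν ξ (m n) (K n) (L n)) {Z : MeasurableRV X}
    (hZ : Filter.Tendsto (fun n => (tableRV ξ (K n) (L n) : MeasurableRV X)) Filter.atTop (𝓝 Z))
    (U : Opens X) : distribution Z U = ν.real U := by
  have hrad : ∀ {θ : ℝ}, 0 < θ → ∀ᶠ n in Filter.atTop, rad (m n) < θ := fun hθ =>
    (tendsto_rad.comp hm).eventually_lt_const hθ
  refine le_antisymm ?_ ?_
  · refine Real.sSup_le ?_ (ν.real_nonneg U)
    rintro t ⟨ε, V, Y, -, hV, hYZ, rfl⟩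
    refine le_of_forall_pos_le_add fun θ hθ => ?_
    -- The margin `η` in `I_ε(U)` varies with the point. Continuity from below gives a uniform
    -- margin outside an event of probability less than `θ / 2`.
    set S : ℕ → Set (ℕ → Bool) := fun k => {ω | Y.map ω ∈ V ∧
      Metric.ball (Y.map ω) (ε + 1 / ((k : ℝ) + 1)) ⊆ (U : Set X)} with hS
    have hSmono : Monotone S := fun i j hij ω hω => ⟨hω.1,
      (Metric.ball_subset_ball (by gcongr)).trans hω.2⟩
    have hSU : ⋃ k, S k = {ω | Y.map ω ∈ V} := by
      ext ω
      simp only [Set.mem_iUnion]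
      refine ⟨fun ⟨_, h⟩ => h.1, fun h => ?_⟩
      obtain ⟨-, η, hη, hball⟩ := hV h
      obtain ⟨k, hk⟩ := exists_nat_one_div_lt hη
      exact ⟨k, h, (Metric.ball_subset_ball (by linarith)).trans hball⟩
    have htend : Filter.Tendsto (fun k => coinMeasure.real (S k)) Filter.atTop
        (𝓝 (coinMeasure.real {ω | Y.map ω ∈ V})) := by
      rw [← hSU]
      exact (ENNReal.tendsto_toReal (measure_ne_top _ _)).comp
        (tendsto_measure_iUnion_atTop hSmono)
    obtain ⟨k, hk⟩ := (htend.eventually_const_lt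
      (show coinMeasure.real {ω | Y.map ω ∈ V} - θ / 2 < _ by linarith)).exists
    have hdist : ∀ᶠ n in Filter.atTop,
        dist (Y : MeasurableRV X) (tableRV ξ (K n) (L n) : MeasurableRV X) < ε :=
      (tendsto_const_nhds.dist hZ).eventually_lt_const hYZ
    obtain ⟨n, hn, hn1, hn2⟩ := (hdist.and ((hrad (show 0 < θ / 2 by linarith)).and
      (hrad (show (0 : ℝ) < 1 / ((k : ℝ) + 1) by positivity)))).exists
    rw [UniformSpace.Completion.dist_eq] at hn
    have h1 := measure_le_of_fanDist_lt hn
    have h2 := (hA n).measure_ball_subset_le hν U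
    have hsub : S k ⊆ {ω | (ε : ℝ) < dist (Y.map ω) ((tableRV ξ (K n) (L n)).map ω)} ∪
        {ω | Metric.ball ((tableRV ξ (K n) (L n)).map ω) (rad (m n)) ⊆ (U : Set X)} := by
      intro ω hω
      by_cases hd : (ε : ℝ) < dist (Y.map ω) ((tableRV ξ (K n) (L n)).map ω)
      · exact .inl hd
      · refine .inr ((Metric.ball_subset_ball' ?_).trans hω.2)
        rw [dist_comm]
        linarith
    have h3 := (measureReal_mono (μ := coinMeasure) hsub).trans (measureReal_union_le _ _)
    linarith
  · refine le_of_forall_pos_le_add fun θ hθ => ?_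
    obtain ⟨ε, hε, hεθ, hνε⟩ := exists_lt_real_shrinkOpens hν U (show 0 < θ / 3 by positivity)
    have hε' : (0 : ℝ) < ε := by exact_mod_cast hε
    have hdist : ∀ᶠ n in Filter.atTop,
        dist (tableRV ξ (K n) (L n) : MeasurableRV X) Z < ε := by
      have := hZ.dist (tendsto_const_nhds (x := Z))
      rw [dist_self] at this
      exact this.eventually_lt_const hε'
    obtain ⟨n, hn, hn1⟩ := (hdist.and (hrad hε')).exists
    -- One `ε` absorbs the adequacy radius, the other is required by the definition of the
    -- distribution. The three losses, each below `θ / 3`, are those of shrinking, of `rad (m n)`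
    -- and of the subtracted `ε`.
    have h1 := (hA n).le_measure_mem hν (V := shrinkOpens ε U) (W := shrinkOpens (2 * ε) U) ?_
    · have h2 : coinMeasure.real {ω | (tableRV ξ (K n) (L n)).map ω ∈ shrinkOpens (ε : ℝ) U} - ε ≤
          distribution Z U := by
        refine le_csSup ⟨1, ?_⟩ ⟨ε, shrinkOpens ε U, tableRV ξ (K n) (L n), hε, subset_rfl, hn, rfl⟩
        rintro t ⟨ε', V, Y, hε', -, -, rfl⟩
        have : (0 : ℝ) < ε' := by exact_mod_cast hε'
        have := measureReal_le_one (μ := coinMeasure) (s := {ω | Y.map ω ∈ V})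
        linarith
      linarith
    · intro x hx y hy
      obtain ⟨-, η, hη, hball⟩ := mem_shrinkOpens.1 hx
      rw [Metric.mem_ball] at hy
      refine mem_shrinkOpens.2 ⟨hball (Metric.mem_ball.2 (by linarith)), η, hη,
        (Metric.ball_subset_ball' ?_).trans hball⟩
      linarith

end

/-! ### The machine -/

/-- The state before stage `k` depends only on the first `k` symbols of `p`, so the prefix code
suffices to recompute it. The first non-zero answer comes when the required level is first reached.
-/
theorem applies_machine {D s p : ℕ → ℕ} {K : ℕ → ℕ} {L : ℕ → List ℕ}
    (h : ∀ n, ∃ k, state D s p k = (n, K n, L n) ∧ ∀ j < k, (state D s p j).1 ≠ n) :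
    Applies (machine D s) p
      (fun x => tableName s (K (x.unpair.1 + 5)) (L (x.unpair.1 + 5)) x.unpair.2) := by
  have hstate : ∀ k, state D s (listName (prefixCode p k)) k = state D s p k := fun k =>
    state_congr fun i hi => listName_prefixCode hi
  intro x
  obtain ⟨k, hk, hmin⟩ := h (x.unpair.1 + 5)
  refine ⟨k, ?_, fun j hj => ?_⟩
  · simp only [machine, Nat.unpair_pair, length_prefixCode, hstate, hk, if_true]
  · simp only [machine, Nat.unpair_pair, length_prefixCode, hstate, if_neg (hmin j hj)]

/-- The shift by five levels makes the steps at most `2 ^ (-(n + 3))`, hence the distance to the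
limit at most `2 ^ (-(n + 2))`. Two such distances stay strictly below `2 ^ (-min m n)`. -/
theorem exists_limit_of_dist_le_rad {X : Type*} [MetricSpace X] {Y : ℕ → ContinuousRV X}
    (hY : ∀ n, dist (Y n) (Y (n + 1)) ≤ rad (n + 5)) :
    (∀ m n, dist (Y m) (Y n) < (2⁻¹ : ℝ) ^ min m n) ∧
      ∃ Z : MeasurableRV X, Filter.Tendsto (fun n => (Y n : MeasurableRV X)) Filter.atTop (𝓝 Z) := by
  have hY' : ∀ n, dist (Y n : MeasurableRV X) (Y (n + 1) : MeasurableRV X) ≤ 1 / 4 / 2 / 2 ^ n :=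
    fun n => by
      rw [UniformSpace.Completion.dist_eq]
      refine (hY n).trans_eq ?_
      rw [rad, pow_add, div_div, div_div, div_eq_div_iff (by positivity) (by positivity)]
      ring
  obtain ⟨Z, hZ⟩ := cauchySeq_tendsto_of_complete (cauchySeq_of_le_geometric_two hY')
  refine ⟨fun m n => ?_, Z, hZ⟩
  have key : ∀ i ≥ min m n, dist (Y i : MeasurableRV X) Z ≤ 1 / 4 * (2⁻¹ : ℝ) ^ min m n :=
    fun i hi => by
      refine (dist_le_of_le_geometric_two_of_tendsto hY' hZ i).trans ?_
      rw [div_eq_mul_inv, ← inv_pow]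
      exact mul_le_mul_of_nonneg_left
        (pow_le_pow_of_le_one (by norm_num) (by norm_num) hi) (by norm_num)
  rw [← UniformSpace.Completion.dist_eq]
  have h1 := dist_triangle_right (Y m : MeasurableRV X) (Y n : MeasurableRV X) Z
  have h2 := key m (min_le_left _ _)
  have h3 := key n (min_le_right _ _)
  have h4 : (0 : ℝ) < (2⁻¹ : ℝ) ^ min m n := by positivity
  linarith

end TTE

theorem mainTheorem4 {X : Type*} [MetricSpace X] (δ : TTE.Representation X)
    (hX : TTE.IsComputableMetricSpace δ) (hsep : TTE.EffectivelySeparable δ) :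
    TTE.ComputablySelectable (TTE.probabilityValuationNaming δ) (TTE.measurableRVNaming δ)
      (fun ν Z => ∀ U : TopologicalSpace.Opens X,
        TTE.distribution Z U = (ν.1.toFun U).toReal) := by
  obtain ⟨D, hDc, hD⟩ := hX.dist_computable
  obtain ⟨ξ, hξ, s, hsc, hs⟩ := hsep
  refine ⟨TTE.machine D s, TTE.computable_machine hDc hsc, fun p ν hp => ?_⟩
  obtain ⟨K, L, hstate, hA, hK, hclose⟩ := TTE.exists_tables hD hs hξ hp
  obtain ⟨hY, Z, hZ⟩ := TTE.exists_limit_of_dist_le_rad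
    (Y := fun n => TTE.tableRV ξ (K (n + 5)) (L (n + 5)))
    fun n => TTE.dist_tableRV_le (hK (n + 5)) (hclose (n + 5))
  refine ⟨_, Z, TTE.applies_machine hstate, ⟨_, fun n => ?_, hY, hZ⟩, fun U =>
    -- Adequacy is indexed one ahead of the level.
    TTE.distribution_eq ν.2 (m := fun n => n + 5 + 1)
      (Filter.tendsto_atTop_mono (fun n => show n ≤ n + 5 + 1 by omega) Filter.tendsto_id)
      (fun n => hA (n + 5)) hZ U⟩
  have : TTE.component (fun x => TTE.tableName s (K (x.unpair.1 + 5)) (L (x.unpair.1 + 5))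
      x.unpair.2) n = TTE.tableName s (K (n + 5)) (L (n + 5)) := by
    funext i
    simp [TTE.component]
  rw [this]
  exact TTE.continuousRVNaming_tableName hs _ _
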